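/- **Source.** For bits $a,g\in\{0,1\}$ let $\rho_a^g$ be density matrices on $\mathbb C^D$ ($\bar a=1-a$). The source is *quasiperfect with parameters* $(\beta,\gamma)$ if there are orthogonal projections $P_a^g,\widetilde P_a^g$ such that, for all $a,g$: (1) $P_a^0+P_a^1=\widetilde P_a^0+\widetilde P_a^1=\mathbf 1$; (2) $\rho_0^0+\rho_0^1=\rho_1^0+\rho_1^1=:H$; (3) $\operatorname{Tr}P_a^gH=1$; (4) there are unitaries $T_a$ with $T_a^\dagger P_a^gT_a=\widetilde P_a^g$ and $T_a^\dagger HT_a=H$; (5) $\widetilde P_a^0H\widetilde P_a^1=0$; (6) $\widetilde P_a^g\rho_{\bar a}^0\widetilde P_a^g=\widetilde P_a^g\rho_{\bar a}^1\widetilde P_a^g$; (7) there are unitaries $S_a$ such that $S_a^\dagger P_a^gS_a$ and $S_a^\dagger\rho_a^gS_a$ are diagonal; (8) $\operatorname{Tr}P_a^g\rho_a^{\bar g}\le\beta$; (9) the absolute values of the eigenvalues of $P_a^gH-\widetilde P_a^gH$, counted with multiplicity, add up to at most $\gamma$. **Parameters.** Integers $0\le m<n$ and $1\le r\le n$, reals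 $\delta,\epsilon_N,\epsilon>0$, $N=\lceil(4+\epsilon_N)n\rceil$, binary matrices $F$ ($r\times n$) and $K$ ($m\times n$). The *conditions* for $(\beta,\gamma)$ and a real $\lambda'$ are: $\frac{\lambda'}{1-\lambda'}\delta\ge\frac12\epsilon+\beta$; every linear combination of rows of $F$ and $K$ in which some row of $K$ occurs has Hamming weight at least $2\big(\frac1{1-\lambda'}\delta+\frac12\gamma+\epsilon\big)n$; and $F$ is a parity check matrix (with $r=n-\dim$ rows) of a linear code that can correct $\lceil(\delta+\epsilon)n\rceil$ errors, i.e. whose nonzero words have weight at least $2\lceil(\delta+\epsilon)n\rceil+1$. **Modified protocol.** Fix $\tilde b\in\mathbb F_2^N$ (the string the box gives to Bob during the transmission). The classical data are $c=(a,g,\pi,R)$ with $a,g\in\mathbb F_2^N$, $\pi$ a permutation of the $N$ positions and $R$ a set of $\lfloor N/2\rfloor$ positions. Put $b=\tilde b$ on $R$, $b=\tilde b+1$ on $\overline R$, and $\Omega=\{i: a_i=b_i\}$. Only data with $|\Omega\cap R|\ge n$ and $|\Omega\cap\overline R|\ge n$ are admitted; $C$ is the set of these, with the uniform distribution. $S_{\mathcal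 P}$, $S_{\mathcal K}$ are the first $n$ positions, in the order given by $\pi$, of $\Omega\cap R$ and of $\Omega\cap\overline R$. The syndrome is $s=F\,g[S_{\mathcal K}]$, and the announcements are $y(c)=(a,g[\overline{S_{\mathcal K}}],R,s,\pi)$. The state on $\mathbb C^C\otimes(\mathbb C^D)^{\otimes N}$ is $\rho=\frac1{|C|}\sum_{c\in C}|c\rangle\langle c|\otimes\bigotimes_i\rho_{a_i}^{g_i}$. A *normalized attack* is a finite POVM $\{F_v\}_{v\in\mathcal V}$ on this space such that: each $v$ has the form $(y,h,j)$ with $y$ a possible announcement, $h\in\mathbb F_2^N$ and $j$ arbitrary; $P(v)=\operatorname{Tr}F_v\rho>0$ for all $v\in\mathcal V$; $P(\mathcal P)>0$, where $\mathcal P$ is the set of views $v$ for which $g$ and $h$ differ in at most $\lfloor\delta n\rfloor$ positions of $S_{\mathcal P}$; $F_v=\Pi_{y}\otimes E_v$ with $E_v\ge0$ and $\Pi_y=\sum_{c:\,y(c)=y}|c\rangle\langle c|$; and for every $h$ there is $E_h\ge0$ such that the $F_v$ whose string is $h$ add up to $\mathbf 1\otimes E_h$. The joint distribution of Alice's key $\kappa\in\mathbb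 F_2^m$ and the view is $P(\kappa,v)=\operatorname{Tr}\big[(\Pi_{y,\kappa}\otimes E_v)\rho\big]$ for $v\in\mathcal P$, where $\Pi_{y,\kappa}$ projects on the $c$ with $y(c)=y$ and $K\,g[S_{\mathcal K}]=\kappa$, and $P(\kappa,v)=2^{-m}P(v)$ for $v\notin\mathcal P$ (if the test fails, the key is chosen uniformly at random). Put $H_P(\kappa\mid v)=-\sum_{\kappa,v}P(\kappa,v)\log_2\frac{P(\kappa,v)}{P(v)}$, with $0\log_2 0=0$. **Theorem.** There exist functions $\epsilon_1(n,m,\epsilon)$ and $N_0(\epsilon)$, depending on nothing else, such that: 1. for all $\epsilon>0$ and $\lambda>0$ there are $\mu(\lambda,\epsilon)>0$ and $C(\lambda,\epsilon)>0$ with $0<\epsilon_1(n,m,\epsilon)\le C(\lambda,\epsilon)e^{-\mu(\lambda,\epsilon)n}$ for all $n,m\ge 0$ with $m\le\lambda n$; 2. for all parameters as above, every source that is quasiperfect with parameters $(\beta,\gamma)$, every $\lambda'$ for which the conditions hold, every $\tilde b$ and every normalized attack, if $n\ge N_0(\epsilon)$ then $H_P(\kappa\mid v)\ge m-\epsilon_1(n,m,\epsilon)$.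 -/

import Mathlib

open scoped ComplexOrder Kronecker

namespace BB84

/-- Bit-strings of length `N`. -/
abbrev Bits (N : ℕ) := Fin N → ZMod 2

/-! ### Quantum sources -/

/-- A source: for a basis-bit `a` and a key-bit `g` it emits the state `ρ a g` on `ℂ ^ D`. -/
abbrev Source (D : ℕ) := ZMod 2 → ZMod 2 → Matrix (Fin D) (Fin D) ℂ

/-- Density matrices: positive semidefinite matrices of trace one. -/
def IsDensityMatrix {ι : Type*} [Fintype ι] (ρ : Matrix ι ι ℂ) : Prop :=
  ρ.PosSemidef ∧ ρ.trace = 1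

/-- Orthogonal projections. -/
def IsProjection {ι : Type*} [Fintype ι] (P : Matrix ι ι ℂ) : Prop :=
  P.IsHermitian ∧ P * P = P

/-- The sum of the absolute values of the eigenvalues of a matrix, counted with multiplicity. -/
noncomputable def absTrace {ι : Type*} [Fintype ι] [DecidableEq ι] (M : Matrix ι ι ℂ) : ℝ :=
  (M.charpoly.roots.map fun z => ‖z‖).sum

/-- The conditions on the projections `P a g` and `Pt a g` in the definition of a quasiperfect
source with parameters `β`, `γ`. The complement of a bit `a` is `a + 1`. -/
structure QuasiperfectWith {D : ℕ} (ρ P Pt : Source D) (β γ : ℝ) : Prop where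
  proj : ∀ a g, IsProjection (P a g)
  proj_tilde : ∀ a g, IsProjection (Pt a g)
  resolution : ∀ a, P a 0 + P a 1 = 1
  resolution_tilde : ∀ a, Pt a 0 + Pt a 1 = 1
  /-- The sum of the two states is the same matrix `H` in both bases. -/
  sum_eq : ρ 0 0 + ρ 0 1 = ρ 1 0 + ρ 1 1
  trace_eq : ∀ a g, (P a g * (ρ 0 0 + ρ 0 1)).trace = 1
  rotation : ∀ a, ∃ T ∈ Matrix.unitaryGroup (Fin D) ℂ,
    (∀ g, T.conjTranspose * P a g * T = Pt a g) ∧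
      T.conjTranspose * (ρ 0 0 + ρ 0 1) * T = ρ 0 0 + ρ 0 1
  orthogonal : ∀ a, Pt a 0 * (ρ 0 0 + ρ 0 1) * Pt a 1 = 0
  split : ∀ a g, Pt a g * ρ (a + 1) 0 * Pt a g = Pt a g * ρ (a + 1) 1 * Pt a g
  diagonal : ∀ a, ∃ S ∈ Matrix.unitaryGroup (Fin D) ℂ, ∀ g,
    (S.conjTranspose * P a g * S).IsDiag ∧ (S.conjTranspose * ρ a g * S).IsDiag
  error_le : ∀ a g, (P a g * ρ a (g + 1)).trace.re ≤ β
  deviation_le : ∀ a g,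
    absTrace (P a g * (ρ 0 0 + ρ 0 1) - Pt a g * (ρ 0 0 + ρ 0 1)) ≤ γ

/-- A source of quantum states that is quasiperfect with parameters `(β, γ)`. -/
def IsQuasiperfect {D : ℕ} (ρ : Source D) (β γ : ℝ) : Prop :=
  (∀ a g, IsDensityMatrix (ρ a g)) ∧ ∃ P Pt : Source D, QuasiperfectWith ρ P Pt β γ

/-! ### The operating parameters -/

/-- The parameters on which Alice and Bob agree before the protocol. -/
structure Parameters where
  /-- length of the key -/
  m : ℕ
  /-- number of bits for the validation test and for the key definition -/
  n : ℕ
  m_lt_n : m < n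
  /-- threshold for the error rate of the validation test -/
  δ : ℝ
  δ_pos : 0 < δ
  /-- fraction of surplus signals -/
  εN : ℝ
  εN_pos : 0 < εN
  /-- security parameter -/
  ε : ℝ
  ε_pos : 0 < ε
  /-- number of rows of the parity check matrix -/
  r : ℕ
  one_le_r : 1 ≤ r
  r_le_n : r ≤ n
  /-- parity check matrix -/
  F : Matrix (Fin r) (Fin n) (ZMod 2)
  /-- privacy amplification matrix -/
  K : Matrix (Fin m) (Fin n) (ZMod 2)

/-- The number of quantum signals that are exchanged. -/
noncomputable def Parameters.N (p : Parameters) : ℕ := ⌈(4 + p.εN) * (p.n : ℝ)⌉₊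

/-- `F` is a parity check matrix of the linear code `C`: it has `n - dim C` rows and `C` is the
set of words that it annihilates. -/
def IsParityCheckMatrix {r n : ℕ} (F : Matrix (Fin r) (Fin n) (ZMod 2))
    (C : Submodule (ZMod 2) (Bits n)) : Prop :=
  r + Module.finrank (ZMod 2) C = n ∧ ∀ g, g ∈ C ↔ F.mulVec g = 0

/-- The linear code `C` can correct `t` errors: its minimum distance is at least `2 t + 1`. -/
def CanCorrect {n : ℕ} (C : Submodule (ZMod 2) (Bits n)) (t : ℕ) : Prop :=
  ∀ g ∈ C, g ≠ 0 → 2 * t + 1 ≤ hammingNorm g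

/-- The conditions on the operating parameters, for a source with parameters `(β, γ)`. -/
structure Conditions (p : Parameters) (β γ lam : ℝ) : Prop where
  lam_spec : p.ε / 2 + β ≤ lam / (1 - lam) * p.δ
  /-- Every linear combination of rows of `F` and `K` that contains at least one row of `K`
  has large weight. -/
  weight : ∀ (x : Bits p.r) (y : Bits p.m), y ≠ 0 →
    2 * (1 / (1 - lam) * p.δ + γ / 2 + p.ε) * (p.n : ℝ) ≤
      (hammingNorm (Matrix.vecMul x p.F + Matrix.vecMul y p.K) : ℝ)
  code : ∃ C : Submodule (ZMod 2) (Bits p.n),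
    IsParityCheckMatrix p.F C ∧ CanCorrect C ⌈(p.δ + p.ε) * (p.n : ℝ)⌉₊

/-! ### The classical part of the modified protocol -/

/-- The first `n` positions of `A` with respect to the ordering given by the permutation `π`. -/
def firstPositions {N : ℕ} (n : ℕ) (π : Equiv.Perm (Fin N)) (A : Finset (Fin N)) :
    Finset (Fin N) :=
  A.filter fun i => (A.filter fun j => π j < π i).card < n

/-- `firstPositions n π A` has `n` elements as soon as `A` has at least `n` elements. -/
theorem card_firstPositions {N : ℕ} (n : ℕ) (π : Equiv.Perm (Fin N)) (A : Finset (Fin N))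
    (h : n ≤ A.card) : (firstPositions n π A).card = n := by
  let rk : Fin N → ℕ := fun i => (A.filter fun j => π j < π i).card
  have hmono : ∀ i ∈ A, ∀ k ∈ A, π i < π k → rk i < rk k := by
    intro i hi k hk hik
    apply Finset.card_lt_card
    rw [Finset.ssubset_iff_of_subset (s₂ := A.filter fun j => π j < π k)]
    · exact ⟨i, Finset.mem_filter.2 ⟨hi, hik⟩, fun h' => lt_irrefl _ (Finset.mem_filter.1 h').2⟩
    · intro j hj
      simp only [Finset.mem_filter] at hj ⊢
      exact ⟨hj.1, hj.2.trans hik⟩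
  have hinj : Set.InjOn rk A := by
    intro i hi k hk hik
    rcases lt_trichotomy (π i) (π k) with h1 | h1 | h1
    · exact absurd hik (hmono i hi k hk h1).ne
    · exact π.injective h1
    · exact absurd hik (hmono k hk i hi h1).ne'
  have himg : A.image rk = Finset.range A.card := by
    apply Finset.eq_of_subset_of_card_le
    · intro x hx
      obtain ⟨i, hi, rfl⟩ := Finset.mem_image.1 hx
      rw [Finset.mem_range]
      apply Finset.card_lt_card
      rw [Finset.ssubset_iff_of_subset (Finset.filter_subset _ _)]
      exact ⟨i, hi, fun h' => lt_irrefl _ (Finset.mem_filter.1 h').2⟩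
    · rw [Finset.card_image_of_injOn hinj, Finset.card_range]
  have h1 : (firstPositions n π A).image rk = Finset.range n := by
    ext x
    constructor
    · intro hx
      obtain ⟨i, hi, rfl⟩ := Finset.mem_image.1 hx
      exact Finset.mem_range.2 (Finset.mem_filter.1 hi).2
    · intro hx
      have hx' : x ∈ A.image rk := by
        rw [himg, Finset.mem_range]
        exact (Finset.mem_range.1 hx).trans_le h
      obtain ⟨i, hi, rfl⟩ := Finset.mem_image.1 hx'
      exact Finset.mem_image_of_mem _ (Finset.mem_filter.2 ⟨hi, Finset.mem_range.1 hx⟩)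
  have hinj' : Set.InjOn rk (firstPositions n π A) :=
    hinj.mono fun i hi => (Finset.mem_filter.1 hi).1
  rw [← Finset.card_image_of_injOn hinj', h1, Finset.card_range]

/-- The substring `g[S]` of length `n`, in increasing order of the positions, for a set `S`
of `n` positions. -/
def substring {N : ℕ} (n : ℕ) (g : Bits N) (S : Finset (Fin N)) : Bits n :=
  fun k => if h : S.card = n then g (S.orderEmbOfFin h k) else 0

/-- Bob's announced basis `b`, recovered from the string `bt` that the box gave to Bob during the
transmission: these agree on `R` and are complementary outside `R`. -/
def basis {N : ℕ} (bt : Bits N) (R : Finset (Fin N)) : Bits N :=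
  fun i => if i ∈ R then bt i else bt i + 1

/-- The positions on which the bases of Alice and Bob agree. -/
def agreement {N : ℕ} (bt a : Bits N) (R : Finset (Fin N)) : Finset (Fin N) :=
  Finset.univ.filter fun i => a i = basis bt R i

/-- The positions `S_P` of the validation test. -/
def testSet {N : ℕ} (n : ℕ) (bt a : Bits N) (R : Finset (Fin N)) (π : Equiv.Perm (Fin N)) :
    Finset (Fin N) :=
  firstPositions n π (agreement bt a R ∩ R)

/-- The positions `S_K` on which the key is defined. -/
def keySet {N : ℕ} (n : ℕ) (bt a : Bits N) (R : Finset (Fin N)) (π : Equiv.Perm (Fin N)) :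
    Finset (Fin N) :=
  firstPositions n π (agreement bt a R ∩ Rᶜ)

/-- The classical data generated by Alice and the box, for a fixed string `bt`: Alice's basis `a`
and bits `g`, the permutation `π` and the set `R` of half of the positions, subject to the check
that the bases agree on at least `n` positions inside `R` and outside `R`.
The syndrome is a function of these data. -/
@[ext]
structure ClassicalState (p : Parameters) (bt : Bits p.N) where
  a : Bits p.N
  g : Bits p.N
  π : Equiv.Perm (Fin p.N)
  R : Finset (Fin p.N)
  card_R : R.card = p.N / 2
  agree_in : p.n ≤ (agreement bt a R ∩ R).card
  agree_out : p.n ≤ (agreement bt a R ∩ Rᶜ).card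

noncomputable instance (p : Parameters) (bt : Bits p.N) : DecidableEq (ClassicalState p bt) :=
  Classical.decEq _

noncomputable instance (p : Parameters) (bt : Bits p.N) : Fintype (ClassicalState p bt) :=
  Fintype.ofInjective
    (fun c : ClassicalState p bt => (c.a, c.g, c.π, c.R))
    (fun c d h => by
      simp only [Prod.mk.injEq] at h
      exact ClassicalState.ext h.1 h.2.1 h.2.2.1 h.2.2.2)

/-- Alice's bits on the positions `S_K`. -/
noncomputable def ClassicalState.keyBits {p : Parameters} {bt : Bits p.N} (c : ClassicalState p bt) : Bits p.n :=
  substring p.n c.g (keySet p.n bt c.a c.R c.π)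

/-- The syndrome `F g[S_K]`. -/
noncomputable def ClassicalState.syndrome {p : Parameters} {bt : Bits p.N} (c : ClassicalState p bt) :
    Bits p.r :=
  p.F.mulVec c.keyBits

/-- The key `K g[S_K]`. -/
noncomputable def ClassicalState.key {p : Parameters} {bt : Bits p.N} (c : ClassicalState p bt) : Bits p.m :=
  p.K.mulVec c.keyBits

/-- The classical announcements: Alice's basis, her bits outside `S_K` (an entry of `gOpen` is
`none` where the bit is not announced), the set `R`, the syndrome and the permutation. -/
structure Announcement (p : Parameters) where
  a : Bits p.N
  gOpen : Fin p.N → Option (ZMod 2)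
  R : Finset (Fin p.N)
  s : Bits p.r
  π : Equiv.Perm (Fin p.N)

/-- The announcements made when the classical data are `c`. -/
noncomputable def ClassicalState.announcement {p : Parameters} {bt : Bits p.N} (c : ClassicalState p bt) :
    Announcement p where
  a := c.a
  gOpen := fun i => if i ∈ keySet p.n bt c.a c.R c.π then none else some (c.g i)
  R := c.R
  s := c.syndrome
  π := c.π

/-- The set of all announcements that are possible. -/
def possibleAnnouncements (p : Parameters) (bt : Bits p.N) : Set (Announcement p) :=
  Set.range (ClassicalState.announcement (p := p) (bt := bt))

/-- The validation test: the announced string `h` and Alice's bits differ in at most `⌊δ n⌋` of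
the positions in `S_P`. -/
def PassesTest (p : Parameters) (bt : Bits p.N) (y : Announcement p) (h : Bits p.N) : Prop :=
  ((testSet p.n bt y.a y.R y.π).filter fun i => y.gOpen i ≠ some (h i)).card ≤
    ⌊p.δ * (p.n : ℝ)⌋₊

/-! ### The quantum part of the modified protocol -/

/-- The tensor product of matrices on `ℂ ^ D`, as a matrix on the `N`-fold tensor power. -/
def tensorMatrix {N D : ℕ} (M : Fin N → Matrix (Fin D) (Fin D) ℂ) :
    Matrix (Fin N → Fin D) (Fin N → Fin D) ℂ :=
  Matrix.of fun x y => ∏ i, M i (x i) (y i)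

/-- Operators on the state space of the `N` transmitted signals. -/
abbrev SignalOp (p : Parameters) (D : ℕ) :=
  Matrix (Fin p.N → Fin D) (Fin p.N → Fin D) ℂ

/-- Operators on the complete space, the tensor product of the classical space with orthonormal
basis `ClassicalState p bt` and the state space of the signals. -/
abbrev SystemOp (p : Parameters) (bt : Bits p.N) (D : ℕ) :=
  Matrix (ClassicalState p bt × (Fin p.N → Fin D)) (ClassicalState p bt × (Fin p.N → Fin D)) ℂ

/-- The projection on the span of the classical basis states that satisfy `A`. -/
noncomputable def classicalProj {p : Parameters} {bt : Bits p.N} (A : ClassicalState p bt → Prop) :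
    Matrix (ClassicalState p bt) (ClassicalState p bt) ℂ :=
  open Classical in Matrix.diagonal fun c => if A c then 1 else 0

/-- The state of the system: the classical data are uniformly distributed, and given the data `c`
the signals are in the product state with factors `ρ (a i) (g i)`. -/
noncomputable def systemState {D : ℕ} (p : Parameters) (bt : Bits p.N) (ρ : Source D) :
    SystemOp p bt D :=
  ∑ c : ClassicalState p bt, ((Fintype.card (ClassicalState p bt) : ℂ)⁻¹) •
    (Matrix.single c c (1 : ℂ) ⊗ₖ tensorMatrix fun i => ρ (c.a i) (c.g i))

/-- Positive operator valued measures with a finite set of outcomes. -/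
def IsPOVM {ι Q : Type*} [Fintype ι] [DecidableEq ι] (V : Finset Q) (F : Q → Matrix ι ι ℂ) :
    Prop :=
  (∀ v ∈ V, (F v).PosSemidef) ∧ ∑ v ∈ V, F v = 1

/-- The probability `Tr F ρ` of an outcome with measurement operator `F` in the state of the
system. -/
noncomputable def bornProb {D : ℕ} (p : Parameters) (bt : Bits p.N) (ρ : Source D)
    (F : SystemOp p bt D) : ℝ :=
  (F * systemState p bt ρ).trace.re

/-- A view `(y, h, j)`: the announcements `y`, the string `h` announced by Bob, and additional
information `j`. -/
abbrev View (p : Parameters) (J : Type*) := Announcement p × Bits p.N × J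

open Classical in
/-- A normalized attack on the modified protocol, for a fixed string `bt`. -/
structure NormalizedAttack {D : ℕ} (p : Parameters) (ρ : Source D) (bt : Bits p.N)
    (J : Type*) where
  /-- the finite set of views -/
  views : Finset (View p J)
  /-- the measurement operators on the complete space -/
  F : View p J → SystemOp p bt D
  /-- the measurement operators on the signals -/
  E : View p J → SignalOp p D
  povm : IsPOVM views F
  possible : ∀ v ∈ views, v.1 ∈ possibleAnnouncements p bt
  prob_pos : ∀ v ∈ views, 0 < bornProb p bt ρ (F v)
  test_pos : 0 < ∑ v ∈ views.filter (fun v => PassesTest p bt v.1 v.2.1), bornProb p bt ρ (F v)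
  E_pos : ∀ v ∈ views, (E v).PosSemidef
  F_eq : ∀ v ∈ views, F v = classicalProj (fun c => c.announcement = v.1) ⊗ₖ E v
  /-- The string `h` is measured before the classical announcements are made. -/
  measure_first : ∀ h : Bits p.N, ∃ Eh : SignalOp p D, Eh.PosSemidef ∧
    ∑ v ∈ views.filter (fun v => v.2.1 = h), F v =
      (1 : Matrix (ClassicalState p bt) (ClassicalState p bt) ℂ) ⊗ₖ Eh

namespace NormalizedAttack

variable {D : ℕ} {p : Parameters} {ρ : Source D} {bt : Bits p.N} {J : Type*}

/-- The probability `P(v)` of a view. -/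
noncomputable def viewProb (A : NormalizedAttack p ρ bt J) (v : View p J) : ℝ :=
  bornProb p bt ρ (A.F v)

open Classical in
/-- The joint probability `P(κ, v)` of Alice's key and the view. If the validation test is not
passed, Alice chooses her key uniformly at random. -/
noncomputable def jointProb (A : NormalizedAttack p ρ bt J) (κ : Bits p.m) (v : View p J) : ℝ :=
  if PassesTest p bt v.1 v.2.1 then
    bornProb p bt ρ (classicalProj (fun c => c.announcement = v.1 ∧ c.key = κ) ⊗ₖ A.E v)
  else ((2 : ℝ) ^ p.m)⁻¹ * A.viewProb v

/-- The conditional Shannon entropy `H(κ | v)` of the key given the view. -/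
noncomputable def condEntropy (A : NormalizedAttack p ρ bt J) : ℝ :=
  -∑ κ : Bits p.m, ∑ v ∈ A.views,
    A.jointProb κ v * Real.logb 2 (A.jointProb κ v / A.viewProb v)

end NormalizedAttack

end BB84

/-!
The security of the modified protocol, with `ε₁ n m ε = 8 (m + 2) (2 n + 1) exp (-ε² n / 8)`.

On the key set Alice prepares the signals in the basis `bt i + 1`, complementary to the basis `bt i`
in which the projections `Pt (bt i) 0`, `Pt (bt i) 1` act. The argument has two halves.

*Inside a small sphere the key is invisible.* Relative to the string `h` announced by Bob, the
projections `Pt` split the space of the signals into error patterns on the key set. A change of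
Alice's bits by `x` multiplies the block of the state between the patterns `e` and `e'` by
`(-1) ^ (x ⬝ (e - e'))` (`QuasiperfectWith.tilde_state_tilde`). If both patterns have fewer than
`q n` errors, where `2 q n` bounds from below the weight of the combinations of rows of `F` and `K`
that involve `K`, then by duality the key can be changed at will by words `x` of syndrome zero that
are orthogonal to `e - e'` (`exists_word_orthogonal`). Hence the part of the state inside the sphere
is the same for all keys (`near_keyState_eq`). By the Cauchy-Schwarz inequality for the positive
form `Tr (E X R Yᴴ)`, the distance of the key from uniform is controlled by the weight outside
the sphere (`sum_abs_jointProb_sub_le`), and the loss of entropy is linear in this distance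
(`mul_logb_div_le`).

*Outside the sphere there is little weight.* The string `h` is measured before the positions are
announced, so the attack enters only through positive operators `E h` with sum `1`. The event that
the test set shows at most `δ n` errors and the key set at least `q n` is bounded by a product
operator with factors `1 - θ` for each error on the test set and `1 + θ` for each error on the key
set (`sum_bits_tail_le`). Since the test set is a uniformly random half of the used positions
(`sum_testPositions_keyPositions_le`), averaging yields at each position `H` plus `θ / 2` times
`Pt b g * H - ρ b g`, where `H` is the sum of the two states of a basis. This difference is bounded
by one operator `Z b` for both values of `g`, with trace at most `γ + 2 β`
(`QuasiperfectWith.exists_bound`). As the tensor product is monotone on positive operators, the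
bound no longer depends on `h`, the operators `E h` add up to `1`, and the trace factorizes. The
choice `θ = ε / 2` makes the result exponentially small (`weight_ratio_le`).
-/

namespace BB84

/-! ### Positive operators and the trace pairing -/

section TracePairing

variable {ι : Type*} [Fintype ι]

theorem posSemidef_real_smul {ι : Type*} {X : Matrix ι ι ℂ} (hX : X.PosSemidef) {r : ℝ}
    (hr : 0 ≤ r) : (r • X).PosSemidef := by
  have h := hX.smul (show (0 : ℂ) ≤ (r : ℂ) by exact_mod_cast hr)
  convert! h using 1

/-- The real part of `Tr (E X)`. For positive `E` and `X` this is the (unnormalized) probability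
of the outcome `E` in the state `X`. -/
noncomputable def tracePair (E X : Matrix ι ι ℂ) : ℝ := (E * X).trace.re

theorem tracePair_add (E X Y : Matrix ι ι ℂ) :
    tracePair E (X + Y) = tracePair E X + tracePair E Y := by
  simp [tracePair, mul_add]

theorem tracePair_sub (E X Y : Matrix ι ι ℂ) :
    tracePair E (X - Y) = tracePair E X - tracePair E Y := by
  simp [tracePair, mul_sub]

theorem tracePair_smul (E X : Matrix ι ι ℂ) (r : ℝ) :
    tracePair E (r • X) = r * tracePair E X := by
  simp [tracePair]

theorem tracePair_sum {κ : Type*} (s : Finset κ) (E : Matrix ι ι ℂ) (X : κ → Matrix ι ι ℂ) :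
    tracePair E (∑ k ∈ s, X k) = ∑ k ∈ s, tracePair E (X k) := by
  simp [tracePair, Finset.mul_sum, Matrix.trace_sum]

theorem tracePair_sum_left {κ : Type*} (s : Finset κ) (E : κ → Matrix ι ι ℂ) (X : Matrix ι ι ℂ) :
    tracePair (∑ k ∈ s, E k) X = ∑ k ∈ s, tracePair (E k) X := by
  simp [tracePair, Finset.sum_mul, Matrix.trace_sum]

variable [DecidableEq ι]

/-- A positive semidefinite matrix is of the form `Bᴴ * B`. -/
theorem exists_eq_conjTranspose_mul_self {A : Matrix ι ι ℂ} (hA : A.PosSemidef) :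
    ∃ B : Matrix ι ι ℂ, A = B.conjTranspose * B := by
  open scoped MatrixOrder Matrix.Norms.L2Operator in
  exact CStarAlgebra.nonneg_iff_eq_star_mul_self.mp hA.nonneg

theorem tracePair_nonneg {E X : Matrix ι ι ℂ} (hE : E.PosSemidef) (hX : X.PosSemidef) :
    0 ≤ tracePair E X := by
  obtain ⟨B, rfl⟩ := exists_eq_conjTranspose_mul_self hE
  have h := (hX.mul_mul_conjTranspose_same B).trace_nonneg
  rw [Matrix.trace_mul_comm, ← mul_assoc] at h
  exact (Complex.le_def.1 h).1

theorem tracePair_mono {E X Y : Matrix ι ι ℂ} (hE : E.PosSemidef) (h : (Y - X).PosSemidef) :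
    tracePair E X ≤ tracePair E Y := by
  have := tracePair_nonneg hE h
  rw [tracePair_sub] at this
  linarith

/-- The Cauchy-Schwarz inequality for the positive sesquilinear form `Tr (E X R Yᴴ)`, in the form
of the arithmetic-geometric mean inequality: splitting `1 = Q + (1 - Q)`, the value of
`Tr (E R)` is determined by that of the `Q`-block up to the tail `Tr (E (1 - Q) R (1 - Q))`. -/
theorem abs_tracePair_sub_block_le {E R Q : Matrix ι ι ℂ} (hE : E.PosSemidef) (hR : R.PosSemidef)
    (hQ : Q.IsHermitian) {η : ℝ} (hη : 0 < η) :
    |tracePair E R - tracePair E (Q * R * Q)| ≤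
      η * tracePair E (Q * R * Q) + (1 + η⁻¹) * tracePair E ((1 - Q) * R * (1 - Q)) := by
  have key : ∀ a b : ℝ, 0 ≤ a ^ 2 * tracePair E (Q * R * Q) +
      a * b * (tracePair E (Q * R * (1 - Q)) + tracePair E ((1 - Q) * R * Q)) +
      b ^ 2 * tracePair E ((1 - Q) * R * (1 - Q)) := by
    intro a b
    have hh : (a • Q + b • (1 - Q)).conjTranspose = a • Q + b • (1 - Q) := by
      simp [Matrix.conjTranspose_add, Matrix.conjTranspose_smul, hQ.eq]
    have h := tracePair_nonneg hE (hR.mul_mul_conjTranspose_same (a • Q + b • (1 - Q)))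
    rw [hh] at h
    have e : (a • Q + b • (1 - Q)) * R * (a • Q + b • (1 - Q)) =
        (a ^ 2) • (Q * R * Q) + (a * b) • (Q * R * (1 - Q) + (1 - Q) * R * Q) +
          (b ^ 2) • ((1 - Q) * R * (1 - Q)) := by
      rw [add_mul, add_mul, mul_add, mul_add]
      simp only [smul_mul_assoc, mul_smul_comm, smul_smul, smul_add]
      rw [mul_comm b a, pow_two, pow_two]
      abel
    rw [e] at h
    simpa only [tracePair_add, tracePair_smul] using h
  have e : R = Q * R * Q + (Q * R * (1 - Q) + (1 - Q) * R * Q) + (1 - Q) * R * (1 - Q) := by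
    noncomm_ring
  have e' : tracePair E R = tracePair E (Q * R * Q) +
      (tracePair E (Q * R * (1 - Q)) + tracePair E ((1 - Q) * R * Q)) +
      tracePair E ((1 - Q) * R * (1 - Q)) := by
    conv_lhs => rw [e]
    simp only [tracePair_add]
  have ht := key 0 1
  have h1 := key η 1
  have h2 := key η (-1)
  set u := tracePair E (Q * R * Q)
  set t := tracePair E ((1 - Q) * R * (1 - Q))
  set x := tracePair E (Q * R * (1 - Q)) + tracePair E ((1 - Q) * R * Q)
  have e1 : x ≤ η * u + η⁻¹ * t := by
    have : η * (η * u + η⁻¹ * t - x) = η ^ 2 * u + t - η * x := by field_simp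
    have h3 : 0 ≤ η * (η * u + η⁻¹ * t - x) := by rw [this]; linarith
    linarith [nonneg_of_mul_nonneg_right h3 hη]
  have e2 : -x ≤ η * u + η⁻¹ * t := by
    have : η * (η * u + η⁻¹ * t + x) = η ^ 2 * u + t + η * x := by field_simp
    have h3 : 0 ≤ η * (η * u + η⁻¹ * t + x) := by rw [this]; linarith
    linarith [nonneg_of_mul_nonneg_right h3 hη]
  rw [e', abs_le]
  constructor <;> linarith

/-- The `Q`-block is at most twice the whole plus twice the tail. -/
theorem tracePair_block_le {E R Q : Matrix ι ι ℂ} (hE : E.PosSemidef) (hR : R.PosSemidef)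
    (hQ : Q.IsHermitian) :
    tracePair E (Q * R * Q) ≤
      2 * tracePair E R + 2 * tracePair E ((1 - Q) * R * (1 - Q)) := by
  have hh : (1 + (1 - Q)).conjTranspose = 1 + (1 - Q) := by
    simp [Matrix.conjTranspose_add, hQ.eq]
  have h := tracePair_nonneg hE (hR.mul_mul_conjTranspose_same (1 + (1 - Q)))
  rw [hh] at h
  have e : (1 + (1 - Q)) * R * (1 + (1 - Q)) + Q * R * Q =
      (2 : ℝ) • R + (2 : ℝ) • ((1 - Q) * R * (1 - Q)) := by
    rw [two_smul, two_smul]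
    noncomm_ring
  have := congrArg (tracePair E) e
  simp only [tracePair_add, tracePair_smul] at this
  linarith

/-- The absolute value of a Hermitian matrix: an operator that dominates `M` and `-M` and whose
trace is the sum of the absolute values of the eigenvalues of `M`. -/
theorem exists_posSemidef_abs {M : Matrix ι ι ℂ} (hM : M.IsHermitian) :
    ∃ A : Matrix ι ι ℂ, A.PosSemidef ∧ (A - M).PosSemidef ∧ (A + M).PosSemidef ∧
      A.trace.re = absTrace M := by
  set U : Matrix ι ι ℂ := ↑hM.eigenvectorUnitary
  have hU : U.conjTranspose * U = 1 :=
    (Matrix.mem_unitaryGroup_iff').1 hM.eigenvectorUnitary.2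
  have hs : M = U * Matrix.diagonal (fun i => (hM.eigenvalues i : ℂ)) * U.conjTranspose := by
    have := hM.spectral_theorem
    rw [Unitary.conjStarAlgAut_apply] at this
    exact this
  have hd : ∀ d : ι → ℝ, (∀ i, 0 ≤ d i) →
      (U * Matrix.diagonal (fun i => (d i : ℂ)) * U.conjTranspose).PosSemidef := fun d hd =>
    (Matrix.PosSemidef.diagonal (by intro i; simpa using hd i)).mul_mul_conjTranspose_same U
  have ha : absTrace M = ∑ i, |hM.eigenvalues i| := by
    rw [absTrace, hM.roots_charpoly_eq_eigenvalues]
    simp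
  rw [ha]
  clear ha
  generalize hM.eigenvalues = l at hs
  refine ⟨U * Matrix.diagonal (fun i => ((|l i| : ℝ) : ℂ)) * U.conjTranspose,
    hd _ fun i => abs_nonneg _, ?_, ?_, ?_⟩
  · rw [hs, ← sub_mul, ← mul_sub, Matrix.diagonal_sub]
    have := hd (fun i => |l i| - l i) (fun i => sub_nonneg.2 (le_abs_self _))
    simpa using this
  · rw [hs, ← add_mul, ← mul_add, Matrix.diagonal_add]
    have := hd (fun i => |l i| + l i) (fun i => by linarith [neg_abs_le (l i)])
    simpa using this
  · rw [Matrix.trace_mul_comm, ← mul_assoc, hU, one_mul, Matrix.trace_diagonal]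
    simp

end TracePairing

/-! ### Tensor products of matrices -/

section Tensor

variable {N D : ℕ}

theorem tensorMatrix_mul (A B : Fin N → Matrix (Fin D) (Fin D) ℂ) :
    tensorMatrix A * tensorMatrix B = tensorMatrix fun i => A i * B i := by
  ext x y
  simp only [tensorMatrix, Matrix.mul_apply, Matrix.of_apply, ← Finset.prod_mul_distrib]
  rw [Finset.prod_univ_sum, Fintype.piFinset_univ]

theorem tensorMatrix_one : tensorMatrix (fun _ : Fin N => (1 : Matrix (Fin D) (Fin D) ℂ)) = 1 := by
  ext x y
  simp only [tensorMatrix, Matrix.of_apply, Matrix.one_apply]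
  by_cases h : x = y
  · simp [h]
  · obtain ⟨i, hi⟩ := Function.ne_iff.1 h
    rw [if_neg h]
    exact Finset.prod_eq_zero (Finset.mem_univ i) (if_neg hi)

theorem tensorMatrix_conjTranspose (A : Fin N → Matrix (Fin D) (Fin D) ℂ) :
    (tensorMatrix A).conjTranspose = tensorMatrix fun i => (A i).conjTranspose := by
  ext x y
  simp [tensorMatrix]

theorem tensorMatrix_smul (c : Fin N → ℝ) (A : Fin N → Matrix (Fin D) (Fin D) ℂ) :
    (tensorMatrix fun i => c i • A i) = (∏ i, c i) • tensorMatrix A := by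
  ext x y
  simp [tensorMatrix, Finset.prod_mul_distrib]

theorem tensorMatrix_eq_zero {A : Fin N → Matrix (Fin D) (Fin D) ℂ} (i : Fin N) (h : A i = 0) :
    tensorMatrix A = 0 := by
  ext x y
  exact Finset.prod_eq_zero (Finset.mem_univ i) (by simp [h])

theorem tensorMatrix_sum {κ : Type*} [Fintype κ] [DecidableEq κ]
    (A : Fin N → κ → Matrix (Fin D) (Fin D) ℂ) :
    (tensorMatrix fun i => ∑ k, A i k) = ∑ f : Fin N → κ, tensorMatrix fun i => A i (f i) := by
  ext x y
  simp only [tensorMatrix, Matrix.of_apply, Matrix.sum_apply]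
  rw [Finset.prod_univ_sum, Fintype.piFinset_univ]

theorem trace_tensorMatrix (A : Fin N → Matrix (Fin D) (Fin D) ℂ) :
    (tensorMatrix A).trace = ∏ i, (A i).trace := by
  simp only [Matrix.trace, Matrix.diag, tensorMatrix, Matrix.of_apply]
  rw [Finset.prod_univ_sum, Fintype.piFinset_univ]

theorem posSemidef_tensorMatrix {A : Fin N → Matrix (Fin D) (Fin D) ℂ}
    (h : ∀ i, (A i).PosSemidef) : (tensorMatrix A).PosSemidef := by
  choose B hB using fun i => exists_eq_conjTranspose_mul_self (h i)
  rw [show A = fun i => (B i).conjTranspose * B i from funext hB, ← tensorMatrix_mul,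
    ← tensorMatrix_conjTranspose]
  exact Matrix.posSemidef_conjTranspose_mul_self _

/-- The tensor product is monotone on positive operators: expanding `⊗ (A i + (B i - A i))`, the
remaining terms are positive. -/
theorem tensorMatrix_mono {A B : Fin N → Matrix (Fin D) (Fin D) ℂ}
    (hA : ∀ i, (A i).PosSemidef) (hAB : ∀ i, (B i - A i).PosSemidef) :
    (tensorMatrix B - tensorMatrix A).PosSemidef := by
  have e : B = fun i => ∑ k : Bool, bif k then A i else B i - A i := by
    funext i; simp
  rw [e, tensorMatrix_sum, ← Finset.add_sum_erase _ _ (Finset.mem_univ fun _ => true)]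
  simp only [cond_true, add_sub_cancel_left]
  refine Matrix.posSemidef_sum _ fun f _ => posSemidef_tensorMatrix fun i => ?_
  cases f i
  · exact hAB i
  · exact hA i

end Tensor

/-! ### A single signal of a quasiperfect source -/

theorem zmod_two_cases (g : ZMod 2) : g = 0 ∨ g = 1 := by
  revert g; decide

theorem zmod_two_add_one_add_one (g : ZMod 2) : g + 1 + 1 = g := by
  revert g; decide

theorem zmod_two_eq_add_one_of_ne {z z' : ZMod 2} (h : z ≠ z') : z' = z + 1 := by
  revert z z'; decide

/-- A sum over a bit, starting from any value. -/
theorem sum_zmod_two {M : Type*} [AddCommMonoid M] (f : ZMod 2 → M) (g : ZMod 2) :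
    ∑ k, f k = f g + f (g + 1) := by
  have h : ∑ k, f k = f 0 + f 1 := Fin.sum_univ_two f
  rcases zmod_two_cases g with rfl | rfl
  · rw [h, zero_add]
  · rw [h, add_comm, show (1 + 1 : ZMod 2) = 0 from rfl]

/-- A projection times a commuting positive operator is positive. -/
theorem IsProjection.posSemidef_mul {ι : Type*} [Fintype ι] {P X : Matrix ι ι ℂ}
    (h : IsProjection P) (hX : X.PosSemidef) (hc : P * X = X * P) : (P * X).PosSemidef := by
  have := hX.mul_mul_conjTranspose_same P
  rwa [h.1.eq, mul_assoc, ← hc, ← mul_assoc, h.2] at this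

theorem isDiag_mul_comm {ι : Type*} [Fintype ι] {A B : Matrix ι ι ℂ}
    (hA : A.IsDiag) (hB : B.IsDiag) : A * B = B * A := by
  classical
  rw [← hA.diagonal_diag, ← hB.diagonal_diag, Matrix.diagonal_mul_diagonal,
    Matrix.diagonal_mul_diagonal]
  simp [mul_comm]

section SingleSignal

variable {D : ℕ} {ρ P Pt : Source D} {β γ : ℝ}

/-- The sum of the two states of a basis, which for a quasiperfect source is the same operator in
both bases. -/
def sumState (ρ : Source D) : Matrix (Fin D) (Fin D) ℂ := ρ 0 0 + ρ 0 1

theorem posSemidef_sumState (hρ : ∀ a g, IsDensityMatrix (ρ a g)) :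
    (sumState ρ).PosSemidef := (hρ 0 0).1.add (hρ 0 1).1

theorem trace_sumState (hρ : ∀ a g, IsDensityMatrix (ρ a g)) : (sumState ρ).trace = 2 := by
  rw [sumState, Matrix.trace_add, (hρ 0 0).2, (hρ 0 1).2]
  norm_num

namespace QuasiperfectWith

theorem add_eq_sumState (h : QuasiperfectWith ρ P Pt β γ) (a g : ZMod 2) :
    ρ a g + ρ a (g + 1) = sumState ρ := by
  rw [← sum_zmod_two (fun k => ρ a k) g, sum_zmod_two (fun k => ρ a k) 0, zero_add, sumState]
  rcases zmod_two_cases a with rfl | rfl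
  · rfl
  · exact h.sum_eq.symm

theorem tilde_add (h : QuasiperfectWith ρ P Pt β γ) (a g : ZMod 2) :
    Pt a g + Pt a (g + 1) = 1 := by
  rw [← sum_zmod_two (fun k => Pt a k) g, sum_zmod_two (fun k => Pt a k) 0, zero_add,
    h.resolution_tilde]

theorem proj_add (h : QuasiperfectWith ρ P Pt β γ) (a g : ZMod 2) :
    P a g + P a (g + 1) = 1 := by
  rw [← sum_zmod_two (fun k => P a k) g, sum_zmod_two (fun k => P a k) 0, zero_add,
    h.resolution]

theorem tilde_mul_tilde_add_one (h : QuasiperfectWith ρ P Pt β γ) (a g : ZMod 2) :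
    Pt a g * Pt a (g + 1) = 0 := by
  rw [eq_sub_of_add_eq' (h.tilde_add a g), mul_sub, mul_one, (h.proj_tilde a g).2, sub_self]

theorem tilde_sumState_tilde (h : QuasiperfectWith ρ P Pt β γ)
    (hρ : ∀ a g, IsDensityMatrix (ρ a g)) (a g : ZMod 2) :
    Pt a g * sumState ρ * Pt a (g + 1) = 0 := by
  have h0 : Pt a 0 * sumState ρ * Pt a 1 = 0 := h.orthogonal a
  rcases zmod_two_cases g with rfl | rfl
  · rwa [zero_add]
  · have := congrArg Matrix.conjTranspose h0
    rw [Matrix.conjTranspose_mul, Matrix.conjTranspose_mul, (h.proj_tilde a 0).1.eq,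
      (h.proj_tilde a 1).1.eq, (posSemidef_sumState hρ).1.eq, Matrix.conjTranspose_zero,
      ← mul_assoc] at this
    exact this

theorem tilde_commute (h : QuasiperfectWith ρ P Pt β γ)
    (hρ : ∀ a g, IsDensityMatrix (ρ a g)) (a g : ZMod 2) :
    Pt a g * sumState ρ = sumState ρ * Pt a g := by
  have h1 := h.tilde_sumState_tilde hρ a g
  have h2 := h.tilde_sumState_tilde hρ a (g + 1)
  rw [zmod_two_add_one_add_one] at h2
  calc Pt a g * sumState ρ = Pt a g * sumState ρ * (Pt a g + Pt a (g + 1)) := by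
        rw [h.tilde_add, mul_one]
    _ = (Pt a g + Pt a (g + 1)) * sumState ρ * Pt a g := by
        rw [mul_add, h1, add_mul, add_mul, h2]
    _ = sumState ρ * Pt a g := by rw [h.tilde_add, one_mul]

theorem proj_commute (h : QuasiperfectWith ρ P Pt β γ) (a g g' : ZMod 2) :
    P a g * ρ a g' = ρ a g' * P a g := by
  obtain ⟨S, hS, hd⟩ := h.diagonal a
  have hS' : S * S.conjTranspose = 1 := Matrix.mem_unitaryGroup_iff.1 hS
  have key : ∀ A B : Matrix (Fin D) (Fin D) ℂ,
      S.conjTranspose * A * S * (S.conjTranspose * B * S) = S.conjTranspose * (A * B) * S := by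
    intro A B
    calc _ = S.conjTranspose * A * (S * S.conjTranspose) * B * S := by simp only [mul_assoc]
      _ = _ := by rw [hS', mul_one]; simp only [mul_assoc]
  have hc := isDiag_mul_comm (hd g).1 (hd g').2
  rw [key, key] at hc
  have hcan : ∀ A : Matrix (Fin D) (Fin D) ℂ,
      S * (S.conjTranspose * A * S) * S.conjTranspose = A := by
    intro A
    calc _ = (S * S.conjTranspose) * A * (S * S.conjTranspose) := by simp only [mul_assoc]
      _ = A := by rw [hS', one_mul, mul_one]
  rw [← hcan (P a g * ρ a g'), hc, hcan]

theorem proj_commute_sumState (h : QuasiperfectWith ρ P Pt β γ) (a g : ZMod 2) :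
    P a g * sumState ρ = sumState ρ * P a g := by
  rw [← h.add_eq_sumState a 0, mul_add, add_mul, h.proj_commute, h.proj_commute]

/-- Changing the key bit of a signal that was prepared in the complementary basis changes a block
of its state only by a sign, which is trivial on the diagonal blocks. -/
theorem tilde_state_tilde (h : QuasiperfectWith ρ P Pt β γ)
    (hρ : ∀ a g, IsDensityMatrix (ρ a g)) (b g x z z' : ZMod 2) :
    Pt b z * ρ (b + 1) (g + x) * Pt b z' =
      (if x ≠ 0 ∧ z ≠ z' then (-1 : ℝ) else 1) • (Pt b z * ρ (b + 1) g * Pt b z') := by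
  rcases zmod_two_cases x with rfl | rfl
  · simp
  by_cases hz : z = z'
  · subst hz
    simp only [ne_eq, not_true_eq_false, and_false, if_false, one_smul]
    have := h.split b z
    rcases zmod_two_cases g with rfl | rfl
    · rw [zero_add, this]
    · rw [show (1 + 1 : ZMod 2) = 0 from rfl, this]
  · rw [if_pos ⟨one_ne_zero, hz⟩, neg_smul, one_smul, zmod_two_eq_add_one_of_ne hz,
      eq_neg_iff_add_eq_zero, ← add_mul, ← mul_add, add_comm (ρ (b + 1) (g + 1)),
      h.add_eq_sumState, h.tilde_sumState_tilde hρ]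

/-- In each basis there is one positive operator of trace at most `γ + 2 β` that bounds the
difference between a signal that is found in `Pt b g` and a signal that is emitted with key bit
`g`, whatever `g` is. -/
theorem exists_bound (h : QuasiperfectWith ρ P Pt β γ)
    (hρ : ∀ a g, IsDensityMatrix (ρ a g)) (b : ZMod 2) :
    ∃ Z : Matrix (Fin D) (Fin D) ℂ, Z.PosSemidef ∧ Z.trace.re ≤ γ + 2 * β ∧
      ∀ g, (Z - (Pt b g * sumState ρ - ρ b g)).PosSemidef := by
  have hH := posSemidef_sumState hρ
  set H := sumState ρ with hHdef
  have hM : (P b 0 * H - Pt b 0 * H).IsHermitian :=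
    ((h.proj b 0).posSemidef_mul hH (h.proj_commute_sumState b 0)).1.sub
      ((h.proj_tilde b 0).posSemidef_mul hH (h.tilde_commute hρ b 0)).1
  obtain ⟨A, hA, hA1, hA2, hAtr⟩ := exists_posSemidef_abs hM
  have hAγ : A.trace.re ≤ γ := hAtr ▸ h.deviation_le b 0
  have hW : ∀ g g', (P b g * ρ b g').PosSemidef := fun g g' =>
    (h.proj b g).posSemidef_mul (hρ b g').1 (h.proj_commute b g g')
  have hAg : ∀ g, (A - (Pt b g * H - P b g * H)).PosSemidef := by
    intro g
    rcases zmod_two_cases g with rfl | rfl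
    · convert hA2 using 1; abel
    · convert hA1 using 1
      have h1 := h.tilde_add b 0
      have h2 := h.proj_add b 0
      rw [zero_add] at h1 h2
      rw [eq_sub_of_add_eq' h1, eq_sub_of_add_eq' h2]
      noncomm_ring
  refine ⟨A + (P b 0 * ρ b 1 + P b 1 * ρ b 0), hA.add ((hW 0 1).add (hW 1 0)), ?_, fun g => ?_⟩
  · have h0 := h.error_le b 0
    have h1 := h.error_le b 1
    rw [zero_add] at h0
    rw [show (1 + 1 : ZMod 2) = 0 from rfl] at h1
    simp only [Matrix.trace_add, Complex.add_re]
    linarith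
  · have hsum : P b 0 * ρ b 1 + P b 1 * ρ b 0 =
        P b g * ρ b (g + 1) + P b (g + 1) * ρ b g := by
      rcases zmod_two_cases g with rfl | rfl
      · rw [zero_add]
      · rw [show (1 + 1 : ZMod 2) = 0 from rfl, add_comm]
    have hP : P b g * H - ρ b g = P b g * ρ b (g + 1) - P b (g + 1) * ρ b g := by
      rw [hHdef, ← h.add_eq_sumState b g, eq_sub_of_add_eq' (h.proj_add b g)]
      noncomm_ring
    have e : A + (P b 0 * ρ b 1 + P b 1 * ρ b 0) - (Pt b g * H - ρ b g) =
        (A - (Pt b g * H - P b g * H)) + (P b (g + 1) * ρ b g + P b (g + 1) * ρ b g) := by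
      have : Pt b g * H - ρ b g = (Pt b g * H - P b g * H) + (P b g * H - ρ b g) := by abel
      rw [this, hP, hsum]
      abel
    rw [e]
    exact (hAg g).add ((hW _ _).add (hW _ _))

theorem beta_nonneg (h : QuasiperfectWith ρ P Pt β γ)
    (hρ : ∀ a g, IsDensityMatrix (ρ a g)) : 0 ≤ β :=
  (Complex.le_def.1 ((h.proj 0 0).posSemidef_mul (hρ 0 _).1
    (h.proj_commute 0 0 _)).trace_nonneg).1.trans (h.error_le 0 0)

theorem gamma_nonneg (h : QuasiperfectWith ρ P Pt β γ) : 0 ≤ γ :=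
  le_trans (Multiset.sum_nonneg fun x hx => by
    obtain ⟨z, _, rfl⟩ := Multiset.mem_map.1 hx; exact norm_nonneg z) (h.deviation_le 0 0)

end QuasiperfectWith

end SingleSignal

/-! ### Symmetry of the classical data -/

/-- If all fibres of a map `X : s → t` have the same size, the average over `s` is the average
over `t`. -/
theorem card_mul_sum_comp_of_equal_fibers {α β : Type*} [DecidableEq β] {s : Finset α}
    {t : Finset β} {X : α → β} (hX : ∀ a ∈ s, X a ∈ t)
    (hk : ∀ b ∈ t, ∀ b' ∈ t, (s.filter fun a => X a = b).card = (s.filter fun a => X a = b').card)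
    (φ : β → ℝ) :
    (t.card : ℝ) * ∑ a ∈ s, φ (X a) = (s.card : ℝ) * ∑ b ∈ t, φ b := by
  rcases t.eq_empty_or_nonempty with rfl | ⟨b₀, hb₀⟩
  · rcases s.eq_empty_or_nonempty with rfl | ⟨a, ha⟩
    · simp
    · exact absurd (hX a ha) (Finset.notMem_empty _)
  set k := (s.filter fun a => X a = b₀).card
  have h1 : ∑ a ∈ s, φ (X a) = k * ∑ b ∈ t, φ b := by
    rw [← Finset.sum_fiberwise_of_maps_to hX, Finset.mul_sum]
    refine Finset.sum_congr rfl fun b hb => ?_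
    rw [Finset.sum_congr rfl fun a ha => by rw [(Finset.mem_filter.1 ha).2], Finset.sum_const,
      nsmul_eq_mul, hk b hb b₀ hb₀]
  have h2 : s.card = t.card * k := by
    rw [Finset.card_eq_sum_card_fiberwise (fun a ha => hX a ha),
      Finset.sum_congr rfl fun b hb => hk b hb b₀ hb₀, Finset.sum_const, smul_eq_mul]
  rw [h1, h2]
  push_cast
  ring

/-- Two subsets of `T` of the same size are related by a permutation that preserves `T`. -/
theorem exists_perm_map_eq {N n : ℕ} {T A A' : Finset (Fin N)} (hA : A ∈ T.powersetCard n)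
    (hA' : A' ∈ T.powersetCard n) :
    ∃ σ : Equiv.Perm (Fin N), A.map σ.toEmbedding = A' ∧ T.map σ.toEmbedding = T := by
  rw [Finset.mem_powersetCard] at hA hA'
  let lab : Finset (Fin N) → Fin N → ℕ := fun B i => if i ∈ B then 0 else if i ∈ T then 1 else 2
  have hlab0 : ∀ B i, lab B i = 0 ↔ i ∈ B := by
    intro B i; simp only [lab]; split_ifs <;> simp_all
  have hlab1 : ∀ B i, lab B i = 1 ↔ i ∈ T \ B := by
    intro B i; simp only [lab]; split_ifs <;> simp_all
  have hlabk : ∀ B, B ⊆ T → ∀ i k, lab B i = k + 2 ↔ i ∉ T ∧ k = 0 := by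
    intro B hB i k
    have := @hB i
    simp only [lab]; split_ifs <;> simp_all [eq_comm]
  have hcard : ∀ c, Fintype.card {i // lab A i = c} = Fintype.card {i // lab A' i = c} := by
    intro c
    rw [Fintype.card_subtype, Fintype.card_subtype]
    match c with
    | 0 => simp only [hlab0]; simp [hA.2, hA'.2]
    | 1 =>
      simp only [hlab1]
      rw [Finset.filter_univ_mem, Finset.filter_univ_mem, Finset.card_sdiff_of_subset hA.1,
        Finset.card_sdiff_of_subset hA'.1, hA.2, hA'.2]
    | k + 2 => simp only [hlabk A hA.1, hlabk A' hA'.1]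
  let σ : Equiv.Perm (Fin N) := Equiv.ofFiberEquiv (f := lab A) (g := lab A')
    fun c => Fintype.equivOfCardEq (hcard c)
  have hσ : ∀ i, lab A' (σ i) = lab A i := fun i => Equiv.ofFiberEquiv_map _ i
  have hT : ∀ B, B ⊆ T → ∀ i, i ∈ T ↔ lab B i ≠ 2 := by
    intro B hB i
    have := hlabk B hB i 0
    simp only [zero_add, and_true] at this
    rw [ne_eq, this, not_not]
  refine ⟨σ, ?_, ?_⟩
  · ext i
    rw [Finset.mem_map_equiv, ← hlab0 A, ← hσ, Equiv.apply_symm_apply, hlab0]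
  · ext i
    rw [Finset.mem_map_equiv, hT A hA.1, ← hσ, Equiv.apply_symm_apply, ← hT A' hA'.1]

theorem firstPositions_subset {N : ℕ} (n : ℕ) (π : Equiv.Perm (Fin N)) (A : Finset (Fin N)) :
    firstPositions n π A ⊆ A := Finset.filter_subset _ _

theorem firstPositions_map {N : ℕ} (n : ℕ) (π σ : Equiv.Perm (Fin N)) (A : Finset (Fin N)) :
    firstPositions n (σ.symm.trans π) (A.map σ.toEmbedding) =
      (firstPositions n π A).map σ.toEmbedding := by
  ext i
  simp only [firstPositions, Finset.mem_filter, Finset.mem_map_equiv, Finset.filter_map,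
    Finset.card_map]
  simp [Function.comp_def]

theorem mem_agreement {N : ℕ} {bt a : Bits N} {R : Finset (Fin N)} {i : Fin N} :
    i ∈ agreement bt a R ↔ a i = basis bt R i := by
  simp [agreement]

theorem agreement_map {N : ℕ} (bt a : Bits N) (R : Finset (Fin N)) (σ : Equiv.Perm (Fin N)) :
    agreement bt (fun i => bt i + (a (σ.symm i) - bt (σ.symm i))) (R.map σ.toEmbedding) =
      (agreement bt a R).map σ.toEmbedding := by
  ext i
  rw [Finset.mem_map_equiv, mem_agreement, mem_agreement]
  simp only [basis, Finset.mem_map_equiv]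
  split_ifs
  · rw [add_eq_left, sub_eq_zero]
  · rw [add_right_inj, sub_eq_iff_eq_add']

namespace ClassicalState

variable {p : Parameters} {bt : Bits p.N}

/-- The positions of the validation test. -/
noncomputable def testPositions (c : ClassicalState p bt) : Finset (Fin p.N) :=
  testSet p.n bt c.a c.R c.π

/-- The positions on which the key is defined. -/
noncomputable def keyPositions (c : ClassicalState p bt) : Finset (Fin p.N) :=
  keySet p.n bt c.a c.R c.π

theorem card_testPositions (c : ClassicalState p bt) : c.testPositions.card = p.n :=
  card_firstPositions _ _ _ c.agree_in

theorem card_keyPositions (c : ClassicalState p bt) : c.keyPositions.card = p.n :=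
  card_firstPositions _ _ _ c.agree_out

theorem a_of_mem_testPositions (c : ClassicalState p bt) {i : Fin p.N}
    (hi : i ∈ c.testPositions) : c.a i = bt i := by
  have h := Finset.mem_inter.1 (firstPositions_subset _ _ _ hi)
  have := (Finset.mem_filter.1 h.1).2
  rwa [basis, if_pos h.2] at this

theorem a_of_mem_keySet {a : Bits p.N} {R : Finset (Fin p.N)} {π : Equiv.Perm (Fin p.N)}
    {i : Fin p.N} (hi : i ∈ keySet p.n bt a R π) : a i = bt i + 1 := by
  have h := Finset.mem_inter.1 (firstPositions_subset _ _ _ hi)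
  have := (Finset.mem_filter.1 h.1).2
  rwa [basis, if_neg (Finset.mem_compl.1 h.2)] at this

theorem disjoint_testPositions_keyPositions (c : ClassicalState p bt) :
    Disjoint c.testPositions c.keyPositions := by
  refine Finset.disjoint_left.2 fun i h1 h2 => ?_
  exact (Finset.mem_compl.1 (Finset.mem_inter.1 (firstPositions_subset _ _ _ h2)).2)
    (Finset.mem_inter.1 (firstPositions_subset _ _ _ h1)).2

/-- Relabelling of the positions. Alice's basis is moved relative to `bt`, so that the agreement
of the bases is carried along. -/
noncomputable def permute (σ : Equiv.Perm (Fin p.N)) (c : ClassicalState p bt) :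
    ClassicalState p bt where
  a := fun i => bt i + (c.a (σ.symm i) - bt (σ.symm i))
  g := c.g
  π := σ.symm.trans c.π
  R := c.R.map σ.toEmbedding
  card_R := by rw [Finset.card_map, c.card_R]
  agree_in := by
    rw [agreement_map, ← Finset.map_inter, Finset.card_map]
    exact c.agree_in
  agree_out := by
    have : (c.R.map σ.toEmbedding)ᶜ = c.Rᶜ.map σ.toEmbedding := by
      ext i; simp only [Finset.mem_compl, Finset.mem_map_equiv]
    rw [agreement_map, this, ← Finset.map_inter, Finset.card_map]
    exact c.agree_out

theorem permute_symm_permute (σ : Equiv.Perm (Fin p.N)) (c : ClassicalState p bt) :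
    permute σ.symm (permute σ c) = c := by
  ext i
  · simp [permute]
  · rfl
  · simp [permute]
  · simp [permute]

theorem testPositions_permute (σ : Equiv.Perm (Fin p.N)) (c : ClassicalState p bt) :
    (permute σ c).testPositions = c.testPositions.map σ.toEmbedding := by
  simp only [testPositions, testSet, permute]
  rw [agreement_map, ← Finset.map_inter, firstPositions_map]

theorem keyPositions_permute (σ : Equiv.Perm (Fin p.N)) (c : ClassicalState p bt) :
    (permute σ c).keyPositions = c.keyPositions.map σ.toEmbedding := by
  have : (c.R.map σ.toEmbedding)ᶜ = c.Rᶜ.map σ.toEmbedding := by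
    ext i; simp only [Finset.mem_compl, Finset.mem_map_equiv]
  simp only [keyPositions, keySet, permute]
  rw [agreement_map, this, ← Finset.map_inter, firstPositions_map]

/-- Given the set `T` of all used positions, every subset of `n` positions is equally likely to be
the set of test positions. Hence an average over the classical data is controlled by the
averages over the subsets of size `n` of the sets `T` of size `2 n`. -/
theorem sum_testPositions_keyPositions_le (f : Finset (Fin p.N) → Finset (Fin p.N) → ℝ) (B : ℝ)
    (hf : ∀ T : Finset (Fin p.N), T.card = 2 * p.n →
      ∑ A ∈ T.powersetCard p.n, f A (T \ A) ≤ B) :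
    (Nat.centralBinom p.n : ℝ) * ∑ c : ClassicalState p bt, f c.testPositions c.keyPositions ≤
      Fintype.card (ClassicalState p bt) * B := by
  let U : ClassicalState p bt → Finset (Fin p.N) := fun c => c.testPositions ∪ c.keyPositions
  have hU : ∀ c, (U c).card = 2 * p.n := fun c => by
    rw [Finset.card_union_of_disjoint c.disjoint_testPositions_keyPositions,
      c.card_testPositions, c.card_keyPositions, two_mul]
  have hsd : ∀ c, U c \ c.testPositions = c.keyPositions := fun c => by
    rw [Finset.union_sdiff_left, Finset.sdiff_eq_self_of_disjoint
      c.disjoint_testPositions_keyPositions.symm]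
  rw [← Finset.sum_fiberwise Finset.univ U, Finset.mul_sum, ← Finset.card_univ,
    Finset.card_eq_sum_card_fiberwise (f := U) (t := Finset.univ) (fun _ _ => by simp)]
  push_cast
  rw [Finset.sum_mul]
  refine Finset.sum_le_sum fun T _ => ?_
  rcases (Finset.univ.filter fun c => U c = T).eq_empty_or_nonempty with he | ⟨c₀, hc₀⟩
  · simp [he]
  have hT : T.card = 2 * p.n := (Finset.mem_filter.1 hc₀).2 ▸ hU c₀
  have h1 : ∑ c with U c = T, f c.testPositions c.keyPositions =
      ∑ c with U c = T, f c.testPositions (T \ c.testPositions) := by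
    refine Finset.sum_congr rfl fun c hc => ?_
    rw [← (Finset.mem_filter.1 hc).2, hsd]
  have h2 := card_mul_sum_comp_of_equal_fibers (s := Finset.univ.filter fun c => U c = T)
    (t := T.powersetCard p.n) (X := testPositions)
    (fun c hc => Finset.mem_powersetCard.2 ⟨(Finset.mem_filter.1 hc).2 ▸
      Finset.subset_union_left, c.card_testPositions⟩) ?_ fun A => f A (T \ A)
  · rw [h1]
    rw [Finset.card_powersetCard, hT] at h2
    rw [Nat.centralBinom, h2]
    exact mul_le_mul_of_nonneg_left (hf T hT) (Nat.cast_nonneg _)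
  · have hle : ∀ A ∈ T.powersetCard p.n, ∀ A' ∈ T.powersetCard p.n,
        ((Finset.univ.filter fun c => U c = T).filter fun c => c.testPositions = A).card ≤
        ((Finset.univ.filter fun c => U c = T).filter fun c => c.testPositions = A').card := by
      intro A hA A' hA'
      obtain ⟨σ, hσ, hσT⟩ := exists_perm_map_eq hA hA'
      refine Finset.card_le_card_of_injOn (permute σ) (fun c hc => ?_) fun c _ d _ hcd => ?_
      · simp only [Finset.coe_filter, Finset.mem_filter, Finset.mem_univ, true_and,
          Set.mem_ofPred_eq, U] at hc ⊢
        rw [testPositions_permute, keyPositions_permute, ← Finset.map_union, hc.1, hc.2]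
        exact ⟨hσT, hσ⟩
      · rw [← permute_symm_permute σ c, hcd, permute_symm_permute]
    exact fun A hA A' hA' => le_antisymm (hle A hA A' hA') (hle A' hA' A hA)

/-- Addition of a string to Alice's bits. -/
def addBits (x : Bits p.N) (c : ClassicalState p bt) : ClassicalState p bt :=
  { c with g := c.g + x }

theorem addBits_addBits (x : Bits p.N) (c : ClassicalState p bt) :
    addBits x (addBits x c) = c := by
  have : c.g + x + x = c.g := by
    funext i
    rw [Pi.add_apply, Pi.add_apply, add_assoc, CharTwo.add_self_eq_zero, add_zero]
  ext i
  · rfl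
  · exact congrFun this i
  · rfl
  · rfl

/-- Alice's bits are uniform and independent of the other data. -/
theorem sum_eq_sum_sum_bits (f : ClassicalState p bt → ℝ) :
    (2 : ℝ) ^ p.N * ∑ c, f c = ∑ c : ClassicalState p bt, ∑ x : Bits p.N, f { c with g := x } := by
  have h1 : ∀ x : Bits p.N, ∑ c : ClassicalState p bt, f (addBits x c) = ∑ c, f c := fun x =>
    Fintype.sum_bijective (addBits x) (Function.Involutive.bijective (addBits_addBits x)) _ _
      fun _ => rfl
  have h2 : ∀ c : ClassicalState p bt,
      ∑ x : Bits p.N, f { c with g := x } = ∑ x, f (addBits x c) := fun c =>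
    (Fintype.sum_equiv (Equiv.addLeft c.g) _ _ fun _ => rfl).symm
  rw [Finset.sum_congr rfl fun c _ => h2 c, Finset.sum_comm, Finset.sum_congr rfl fun x _ => h1 x,
    Finset.sum_const, Finset.card_univ, nsmul_eq_mul]
  congr 1
  simp [ZMod.card]

end ClassicalState

/-! ### Error patterns in the complementary basis -/

section Pattern

variable {N D : ℕ} {ρ P Pt : Source D} {β γ : ℝ}

/-- The factor at position `i` of the projection on the error pattern `e`: on `S` it tests for the
bit `h i + e` with the projections `Pt` in the basis `bt i`; outside `S` nothing is tested, which
is encoded by the family `1, 0` of projections. -/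
noncomputable def errorProj (Pt : Source D) (bt h : Bits N) (S : Finset (Fin N)) (i : Fin N)
    (e : ZMod 2) : Matrix (Fin D) (Fin D) ℂ :=
  if i ∈ S then Pt (bt i) (h i + e) else if e = 0 then 1 else 0

/-- The projection on the error pattern `e`, relative to the string `h`, on the positions `S`. It
vanishes unless `e` is supported on `S`. -/
noncomputable def patternProj (Pt : Source D) (bt h : Bits N) (S : Finset (Fin N)) (e : Bits N) :
    Matrix (Fin N → Fin D) (Fin N → Fin D) ℂ :=
  tensorMatrix fun i => errorProj Pt bt h S i (e i)

/-- The number of errors of a pattern on the positions `S`. -/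
def errorCount (S : Finset (Fin N)) (e : Bits N) : ℕ := (S.filter fun i => e i ≠ 0).card

/-- The projection on the patterns with fewer than `k` errors: the bits on `S` are in a small
sphere around `h`. -/
noncomputable def nearProj (Pt : Source D) (bt h : Bits N) (S : Finset (Fin N)) (k : ℕ) :
    Matrix (Fin N → Fin D) (Fin N → Fin D) ℂ :=
  ∑ e with errorCount S e < k, patternProj Pt bt h S e

variable {bt h : Bits N} {S : Finset (Fin N)}

theorem isProjection_errorProj (hq : QuasiperfectWith ρ P Pt β γ) (i : Fin N) (e : ZMod 2) :
    IsProjection (errorProj Pt bt h S i e) := by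
  unfold errorProj
  split_ifs
  · exact hq.proj_tilde _ _
  · exact ⟨Matrix.isHermitian_one, mul_one _⟩
  · exact ⟨Matrix.isHermitian_zero, mul_zero _⟩

theorem errorProj_mul_of_ne (hq : QuasiperfectWith ρ P Pt β γ) (i : Fin N) {e e' : ZMod 2}
    (he : e ≠ e') : errorProj Pt bt h S i e * errorProj Pt bt h S i e' = 0 := by
  unfold errorProj
  split_ifs with h1 h2 h3
  · rw [zmod_two_eq_add_one_of_ne he, ← add_assoc, hq.tilde_mul_tilde_add_one]
  · exact absurd (h2.trans h3.symm) he
  · rw [mul_zero]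
  · rw [zero_mul]
  · rw [zero_mul]

theorem sum_errorProj (hq : QuasiperfectWith ρ P Pt β γ) (i : Fin N) :
    ∑ e, errorProj Pt bt h S i e = 1 := by
  rw [sum_zmod_two _ 0]
  by_cases hi : i ∈ S
  · simp only [errorProj, hi, if_true, zero_add, add_zero, hq.tilde_add]
  · simp [errorProj, hi]

theorem isHermitian_patternProj (hq : QuasiperfectWith ρ P Pt β γ) (e : Bits N) :
    (patternProj Pt bt h S e).IsHermitian := by
  rw [Matrix.IsHermitian, patternProj, tensorMatrix_conjTranspose]
  congr 1
  funext i
  exact (isProjection_errorProj hq i _).1.eq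

theorem sum_patternProj (hq : QuasiperfectWith ρ P Pt β γ) :
    ∑ e, patternProj Pt bt h S e = 1 := by
  rw [← tensorMatrix_one]
  simp only [patternProj]
  rw [← tensorMatrix_sum fun i e => errorProj Pt bt h S i e]
  simp only [sum_errorProj hq]

theorem isHermitian_nearProj (hq : QuasiperfectWith ρ P Pt β γ) (k : ℕ) :
    (nearProj Pt bt h S k).IsHermitian := by
  rw [Matrix.IsHermitian, nearProj, Matrix.conjTranspose_sum]
  exact Finset.sum_congr rfl fun e _ => isHermitian_patternProj hq e

theorem one_sub_nearProj (hq : QuasiperfectWith ρ P Pt β γ) (k : ℕ) :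
    1 - nearProj Pt bt h S k = ∑ e with k ≤ errorCount S e, patternProj Pt bt h S e := by
  rw [← sum_patternProj (bt := bt) (h := h) (S := S) hq, nearProj, sub_eq_iff_eq_add',
    ← Finset.sum_filter_add_sum_filter_not _ (fun e => errorCount S e < k)]
  simp only [not_lt]

/-- A product operator that commutes with the error projections has no off-diagonal blocks. -/
theorem far_mul_tensorMatrix_mul_far (hq : QuasiperfectWith ρ P Pt β γ) (k : ℕ)
    {X : Fin N → Matrix (Fin D) (Fin D) ℂ}
    (hX : ∀ i e, errorProj Pt bt h S i e * X i = X i * errorProj Pt bt h S i e) :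
    (1 - nearProj Pt bt h S k) * tensorMatrix X * (1 - nearProj Pt bt h S k) =
      ∑ e with k ≤ errorCount S e, tensorMatrix fun i => errorProj Pt bt h S i (e i) * X i := by
  rw [one_sub_nearProj hq, Finset.sum_mul, Finset.sum_mul]
  refine Finset.sum_congr rfl fun e he => ?_
  rw [Finset.mul_sum, Finset.sum_eq_single_of_mem e he]
  · simp only [patternProj]
    rw [tensorMatrix_mul, tensorMatrix_mul]
    congr 1
    funext i
    rw [mul_assoc, ← hX, ← mul_assoc, (isProjection_errorProj hq i _).2]
  · intro e' _ hne
    obtain ⟨i, hi⟩ := Function.ne_iff.1 hne.symm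
    simp only [patternProj]
    rw [tensorMatrix_mul, tensorMatrix_mul]
    refine tensorMatrix_eq_zero i ?_
    rw [mul_assoc, ← hX, ← mul_assoc, errorProj_mul_of_ne hq i hi, zero_mul]

theorem prod_errorWeight (S : Finset (Fin N)) (e : Bits N) (r : ℝ) :
    ∏ i, (if i ∈ S ∧ e i ≠ 0 then r else 1) = r ^ errorCount S e := by
  rw [Finset.prod_ite, Finset.prod_const, Finset.prod_const_one, mul_one, errorCount]
  congr 2
  ext i
  simp

/-- Exponential Markov inequality: the indicator of at least `k` errors is at most
`(1 + θ) ^ (errors - k)`, which is a product operator. -/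
theorem tracePair_far_le (hq : QuasiperfectWith ρ P Pt β γ) (k : ℕ)
    {E : Matrix (Fin N → Fin D) (Fin N → Fin D) ℂ} (hE : E.PosSemidef)
    {X : Fin N → Matrix (Fin D) (Fin D) ℂ} (hX₀ : ∀ i, (X i).PosSemidef)
    (hX : ∀ i ∈ S, ∀ z, Pt (bt i) z * X i = X i * Pt (bt i) z) {θ : ℝ} (hθ : 0 ≤ θ) :
    (1 + θ) ^ k * tracePair E
        ((1 - nearProj Pt bt h S k) * tensorMatrix X * (1 - nearProj Pt bt h S k)) ≤
      tracePair E (tensorMatrix fun i =>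
        if i ∈ S then X i + θ • (Pt (bt i) (h i + 1) * X i) else X i) := by
  have hX' : ∀ i e, errorProj Pt bt h S i e * X i = X i * errorProj Pt bt h S i e := by
    intro i e
    unfold errorProj
    split_ifs with h1
    · exact hX i h1 _
    · simp
    · simp
  have hpos : ∀ e : Bits N, 0 ≤ tracePair E
      (tensorMatrix fun i => errorProj Pt bt h S i (e i) * X i) := fun e =>
    tracePair_nonneg hE (posSemidef_tensorMatrix fun i =>
      (isProjection_errorProj hq i _).posSemidef_mul (hX₀ i) (hX' i _))
  have hexp : (tensorMatrix fun i =>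
      if i ∈ S then X i + θ • (Pt (bt i) (h i + 1) * X i) else X i) =
      ∑ e : Bits N, (1 + θ) ^ errorCount S e •
        tensorMatrix fun i => errorProj Pt bt h S i (e i) * X i := by
    have : (fun i => if i ∈ S then X i + θ • (Pt (bt i) (h i + 1) * X i) else X i) = fun i =>
        ∑ e, (if i ∈ S ∧ e ≠ 0 then 1 + θ else 1) • (errorProj Pt bt h S i e * X i) := by
      funext i
      rw [sum_zmod_two _ 0]
      by_cases hi : i ∈ S
      · simp only [hi, errorProj, if_true, true_and, ne_eq, not_true_eq_false, if_false, zero_add,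
          one_ne_zero, not_false_eq_true, one_smul, add_zero]
        rw [add_smul, one_smul, ← add_assoc, ← add_mul, hq.tilde_add, one_mul]
      · simp [hi, errorProj]
    rw [this, tensorMatrix_sum]
    refine Finset.sum_congr rfl fun e _ => ?_
    rw [tensorMatrix_smul (fun i => if i ∈ S ∧ e i ≠ 0 then 1 + θ else 1), prod_errorWeight]
  rw [far_mul_tensorMatrix_mul_far hq k hX', hexp, tracePair_sum, tracePair_sum, Finset.mul_sum]
  simp only [tracePair_smul]
  refine (Finset.sum_le_sum fun e he => ?_).trans (Finset.sum_le_sum_of_subset_of_nonneg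
    (Finset.filter_subset _ _) fun e _ _ => mul_nonneg (by positivity) (hpos e))
  exact mul_le_mul_of_nonneg_right
    (pow_le_pow_right₀ (by linarith) (Finset.mem_filter.1 he).2) (hpos e)

end Pattern

/-! ### Few errors on the test set and many errors on the key set are unlikely -/

section Sampling

variable {N D : ℕ} {ρ P Pt : Source D} {β γ : ℝ}

theorem tensorMatrix_add (A B : Fin N → Matrix (Fin D) (Fin D) ℂ) :
    (tensorMatrix fun i => A i + B i) =
      ∑ t : Finset (Fin N), tensorMatrix fun i => if i ∈ t then A i else B i := by
  ext x y
  simp only [tensorMatrix, Matrix.of_apply, Matrix.sum_apply, Matrix.add_apply]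
  rw [Finset.prod_add, Finset.powerset_univ]
  refine Finset.sum_congr rfl fun t _ => ?_
  rw [← Finset.prod_mul_prod_compl t fun i => (if i ∈ t then A i else B i) (x i) (y i),
    Finset.compl_eq_univ_sdiff]
  congr 1
  · exact Finset.prod_congr rfl fun i hi => by rw [if_pos hi]
  · exact Finset.prod_congr rfl fun i hi => by rw [if_neg (Finset.mem_sdiff.1 hi).2]

/-- The product operator that weighs each error on the test set `A` with `1 - θ` and each error on
the key set `B` with `1 + θ`, relative to the string `h`. -/
noncomputable def weightOp (ρ Pt : Source D) (bt h : Bits N) (θ : ℝ) (A B : Finset (Fin N)) :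
    Matrix (Fin N → Fin D) (Fin N → Fin D) ℂ :=
  tensorMatrix fun i =>
    if i ∈ B then sumState ρ + θ • (Pt (bt i) (h i + 1) * sumState ρ)
    else if i ∈ A then sumState ρ - θ • ρ (bt i) (h i + 1) else sumState ρ

theorem posSemidef_testFactor (hq : QuasiperfectWith ρ P Pt β γ)
    (hρ : ∀ a g, IsDensityMatrix (ρ a g)) {θ : ℝ} (hθ1 : θ ≤ 1) (b g : ZMod 2) :
    (sumState ρ - θ • ρ b g).PosSemidef := by
  have : sumState ρ - θ • ρ b g = (1 - θ) • ρ b g + ρ b (g + 1) := by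
    rw [← hq.add_eq_sumState b g, sub_smul, one_smul]
    abel
  rw [this]
  exact (posSemidef_real_smul (hρ b g).1 (by linarith)).add (hρ b _).1

theorem posSemidef_keyFactor (hq : QuasiperfectWith ρ P Pt β γ)
    (hρ : ∀ a g, IsDensityMatrix (ρ a g)) {θ : ℝ} (hθ : 0 ≤ θ) (b g : ZMod 2) :
    (sumState ρ + θ • (Pt b g * sumState ρ)).PosSemidef :=
  (posSemidef_sumState hρ).add (posSemidef_real_smul ((hq.proj_tilde b g).posSemidef_mul
    (posSemidef_sumState hρ) (hq.tilde_commute hρ b g)) hθ)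

/-- Averaged over the ways to split `T` into a test set and a key set, the weight operator is
dominated by a product operator that does not depend on `h`: the terms of first order in `θ`
combine to `Pt b g * H - ρ b g`, which is bounded independently of `g`. -/
theorem sum_tracePair_weightOp_le (hq : QuasiperfectWith ρ P Pt β γ)
    (hρ : ∀ a g, IsDensityMatrix (ρ a g)) {θ : ℝ} (hθ : 0 ≤ θ) (hθ1 : θ ≤ 1)
    {Z : ZMod 2 → Matrix (Fin D) (Fin D) ℂ}
    (hZ : ∀ b g, (Z b - (Pt b g * sumState ρ - ρ b g)).PosSemidef)
    {E : Matrix (Fin N → Fin D) (Fin N → Fin D) ℂ} (hE : E.PosSemidef) (bt h : Bits N)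
    (T : Finset (Fin N)) (n : ℕ) :
    ∑ A ∈ T.powersetCard n, tracePair E (weightOp ρ Pt bt h θ A (T \ A)) ≤
      tracePair E (tensorMatrix fun i =>
        if i ∈ T then (2 : ℝ) • sumState ρ + θ • Z (bt i) else sumState ρ) := by
  have hH := posSemidef_sumState hρ
  set H := sumState ρ with hHdef
  let G : Fin N → Matrix (Fin D) (Fin D) ℂ := fun i =>
    if i ∈ T then H - θ • ρ (bt i) (h i + 1) else 0
  let K : Fin N → Matrix (Fin D) (Fin D) ℂ := fun i =>
    if i ∈ T then H + θ • (Pt (bt i) (h i + 1) * H) else H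
  have hG : ∀ i, (G i).PosSemidef := fun i => by
    simp only [G]; split_ifs
    · exact posSemidef_testFactor hq hρ hθ1 _ _
    · exact Matrix.PosSemidef.zero
  have hK : ∀ i, (K i).PosSemidef := fun i => by
    simp only [K]; split_ifs
    · exact posSemidef_keyFactor hq hρ hθ _ _
    · exact hH
  have h1 : ∑ A ∈ T.powersetCard n, tracePair E (weightOp ρ Pt bt h θ A (T \ A)) ≤
      tracePair E (tensorMatrix fun i => G i + K i) := by
    rw [tensorMatrix_add, tracePair_sum]
    refine le_trans (le_of_eq (Finset.sum_congr rfl fun A hA => ?_))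
      (Finset.sum_le_sum_of_subset_of_nonneg (Finset.subset_univ (T.powersetCard n))
        fun t _ _ => tracePair_nonneg hE (posSemidef_tensorMatrix fun i => ?_))
    · have hAT := (Finset.mem_powersetCard.1 hA).1
      rw [weightOp]
      congr 2
      funext i
      by_cases hiA : i ∈ A
      · simp [hiA, hAT hiA, G, hHdef]
      · simp [hiA, K, hHdef]
    · split_ifs
      · exact hG i
      · exact hK i
  refine h1.trans (tracePair_mono hE (tensorMatrix_mono (fun i => (hG i).add (hK i)) fun i => ?_))
  simp only [G, K]
  split_ifs
  · convert posSemidef_real_smul (hZ (bt i) (h i + 1)) hθ using 1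
    simp only [smul_sub, two_smul]
    abel
  · convert Matrix.PosSemidef.zero using 1
    simp

theorem trace_eq_ofReal_re {ι : Type*} [Fintype ι] {A : Matrix ι ι ℂ} (hA : A.PosSemidef) :
    A.trace = (A.trace.re : ℂ) :=
  Complex.ext rfl (by simpa using (Complex.le_def.1 hA.trace_nonneg).2.symm)

/-- The trace of the dominating operator factorizes over the positions. -/
theorem trace_dominating_le (hρ : ∀ a g, IsDensityMatrix (ρ a g)) {θ x : ℝ} (hθ : 0 ≤ θ)
    {Z : ZMod 2 → Matrix (Fin D) (Fin D) ℂ} (hZ₀ : ∀ b, (Z b).PosSemidef)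
    (hZ : ∀ b, (Z b).trace.re ≤ x) (bt : Bits N) (T : Finset (Fin N)) :
    (tensorMatrix fun i =>
        if i ∈ T then (2 : ℝ) • sumState ρ + θ • Z (bt i) else sumState ρ).trace.re ≤
      2 ^ N * (2 + θ * x / 2) ^ T.card := by
  have hH := posSemidef_sumState hρ
  have hpos : ∀ i, (if i ∈ T then (2 : ℝ) • sumState ρ + θ • Z (bt i)
      else sumState ρ).PosSemidef := fun i => by
    split_ifs
    · exact (posSemidef_real_smul hH two_pos.le).add (posSemidef_real_smul (hZ₀ _) hθ)
    · exact hH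
  rw [trace_tensorMatrix, Finset.prod_congr rfl fun i _ => trace_eq_ofReal_re (hpos i),
    ← Complex.ofReal_prod, Complex.ofReal_re]
  have h2 : (2 : ℝ) ^ N * (2 + θ * x / 2) ^ T.card =
      ∏ i, (2 * if i ∈ T then 2 + θ * x / 2 else 1) := by
    rw [Finset.prod_mul_distrib, Finset.prod_const, Finset.card_univ, Fintype.card_fin,
      Finset.prod_ite, Finset.prod_const, Finset.prod_const_one, mul_one]
    congr 3
    ext i
    simp
  rw [h2]
  refine Finset.prod_le_prod (fun i _ => (Complex.le_def.1 (hpos i).trace_nonneg).1) fun i _ => ?_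
  split_ifs
  · have := mul_le_mul_of_nonneg_left (hZ (bt i)) hθ
    simp only [Matrix.trace_add, Matrix.trace_smul, trace_sumState hρ, Complex.add_re,
      Complex.real_smul, Complex.re_ofReal_mul, Complex.re_ofNat]
    linarith
  · rw [trace_sumState hρ]
    simp

end Sampling

namespace ClassicalState

variable {p : Parameters} {bt : Bits p.N} {D : ℕ} {ρ P Pt : Source D} {β γ : ℝ}

/-- The state of the signals when the classical data are `c`. -/
noncomputable def signalState (ρ : Source D) (c : ClassicalState p bt) : SignalOp p D :=
  tensorMatrix fun i => ρ (c.a i) (c.g i)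

theorem posSemidef_signalState (hρ : ∀ a g, IsDensityMatrix (ρ a g)) (c : ClassicalState p bt) :
    (c.signalState ρ).PosSemidef :=
  posSemidef_tensorMatrix fun _ => (hρ _ _).1

/-- Given the announcements of `c`, the validation test compares the bits on the test set. -/
theorem passesTest_announcement_iff (c : ClassicalState p bt) (h : Bits p.N) :
    PassesTest p bt c.announcement h ↔
      errorCount c.testPositions (c.g - h) ≤ ⌊p.δ * (p.n : ℝ)⌋₊ := by
  have : (c.testPositions.filter fun i => c.announcement.gOpen i ≠ some (h i)) =
      c.testPositions.filter fun i => (c.g - h) i ≠ 0 := by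
    refine Finset.filter_congr fun i hi => ?_
    have hi' : i ∉ keySet p.n bt c.a c.R c.π :=
      Finset.disjoint_left.1 c.disjoint_testPositions_keyPositions hi
    simp only [announcement, if_neg hi', Pi.sub_apply, ne_eq, Option.some.injEq, sub_eq_zero]
  rw [errorCount, ← this]
  rfl

open Classical in
/-- For fixed positions and basis, the average over Alice's bits of the probability that the
validation test is passed although the bits on the key set are far from `h`. -/
theorem sum_bits_tail_le (hq : QuasiperfectWith ρ P Pt β γ)
    (hρ : ∀ a g, IsDensityMatrix (ρ a g)) {θ : ℝ} (hθ : 0 ≤ θ) (hθ1 : θ ≤ 1) (k : ℕ)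
    {E : SignalOp p D} (hE : E.PosSemidef) (h : Bits p.N) (c : ClassicalState p bt) :
    (1 - θ) ^ ⌊p.δ * (p.n : ℝ)⌋₊ * (1 + θ) ^ k *
        ∑ x : Bits p.N, (if PassesTest p bt ({ c with g := x } : ClassicalState p bt).announcement h
          then tracePair E ((1 - nearProj Pt bt h c.keyPositions k) *
            ({ c with g := x } : ClassicalState p bt).signalState ρ *
            (1 - nearProj Pt bt h c.keyPositions k)) else 0) ≤
      tracePair E (weightOp ρ Pt bt h θ c.testPositions c.keyPositions) := by
  set Q := 1 - nearProj Pt bt h c.keyPositions k with hQ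
  have hQh : Q.conjTranspose = Q := by
    rw [hQ, Matrix.conjTranspose_sub, Matrix.conjTranspose_one, (isHermitian_nearProj hq k).eq]
  have hpos : ∀ x : Bits p.N, 0 ≤ tracePair E
      (Q * ({ c with g := x } : ClassicalState p bt).signalState ρ * Q) := fun x => by
    have := (posSemidef_signalState hρ
      ({ c with g := x } : ClassicalState p bt)).mul_mul_conjTranspose_same Q
    rw [hQh] at this
    exact tracePair_nonneg hE this
  let X : Fin p.N → Matrix (Fin D) (Fin D) ℂ := fun i =>
    if i ∈ c.testPositions then sumState ρ - θ • ρ (bt i) (h i + 1) else sumState ρ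
  have hX₀ : ∀ i, (X i).PosSemidef := fun i => by
    simp only [X]; split_ifs
    · exact posSemidef_testFactor hq hρ hθ1 _ _
    · exact posSemidef_sumState hρ
  have hnt : ∀ i ∈ c.keyPositions, i ∉ c.testPositions := fun i hi =>
    Finset.disjoint_right.1 c.disjoint_testPositions_keyPositions hi
  have hsum : tensorMatrix X = ∑ x : Bits p.N, (1 - θ) ^ errorCount c.testPositions (x - h) •
      ({ c with g := x } : ClassicalState p bt).signalState ρ := by
    have : X = fun i => ∑ g, (if i ∈ c.testPositions ∧ g - h i ≠ 0 then 1 - θ else 1) •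
        ρ (c.a i) g := by
      funext i
      rw [sum_zmod_two _ (h i)]
      simp only [X]
      by_cases hi : i ∈ c.testPositions
      · simp only [hi, if_true, true_and, sub_self, ne_eq, not_true_eq_false, if_false, one_smul,
          add_sub_cancel_left, one_ne_zero, not_false_eq_true, c.a_of_mem_testPositions hi]
        rw [← hq.add_eq_sumState (bt i) (h i), sub_smul, one_smul]
        abel
      · simp [hi, hq.add_eq_sumState]
    rw [this, tensorMatrix_sum]
    refine Finset.sum_congr rfl fun x _ => ?_
    rw [tensorMatrix_smul fun i => if i ∈ c.testPositions ∧ x i - h i ≠ 0 then 1 - θ else 1]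
    rw [← prod_errorWeight c.testPositions (x - h)]
    rfl
  have hfar := tracePair_far_le (S := c.keyPositions) (bt := bt) (h := h) hq k hE hX₀
    (fun i hi z => by simp only [X, if_neg (hnt i hi)]; exact hq.tilde_commute hρ _ _) hθ
  have hW : (tensorMatrix fun i => if i ∈ c.keyPositions then
      X i + θ • (Pt (bt i) (h i + 1) * X i) else X i) =
      weightOp ρ Pt bt h θ c.testPositions c.keyPositions := by
    rw [weightOp]
    congr 1
    funext i
    by_cases hi : i ∈ c.keyPositions
    · simp [hi, X, hnt i hi]
    · simp [hi, X]
  rw [hW, ← hQ, hsum, Finset.mul_sum, Finset.sum_mul, tracePair_sum] at hfar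
  refine le_trans ?_ hfar
  rw [mul_comm ((1 - θ) ^ _), mul_assoc]
  refine mul_le_mul_of_nonneg_left ?_ (by positivity)
  rw [Finset.mul_sum]
  refine Finset.sum_le_sum fun x _ => ?_
  rw [mul_smul_comm, smul_mul_assoc, tracePair_smul]
  have h1θ : 0 ≤ 1 - θ := by linarith
  split_ifs with hp
  · refine mul_le_mul_of_nonneg_right (pow_le_pow_of_le_one h1θ (by linarith) ?_) (hpos x)
    exact (passesTest_announcement_iff _ _).1 hp
  · rw [mul_zero]
    exact mul_nonneg (by positivity) (hpos x)

open Classical in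
/-- The probability that the validation test is passed although the bits on the key set, measured
in the basis `bt`, are far from the string `h`, in multiplicative form. -/
theorem sum_tail_le (hq : QuasiperfectWith ρ P Pt β γ)
    (hρ : ∀ a g, IsDensityMatrix (ρ a g)) {θ : ℝ} (hθ : 0 ≤ θ) (hθ1 : θ ≤ 1) (k : ℕ)
    {E : Bits p.N → SignalOp p D} (hE : ∀ h, (E h).PosSemidef) (hE1 : ∑ h, E h = 1) :
    (Nat.centralBinom p.n : ℝ) * ((1 - θ) ^ ⌊p.δ * (p.n : ℝ)⌋₊ * (1 + θ) ^ k *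
        ∑ c : ClassicalState p bt, ∑ h : Bits p.N, if PassesTest p bt c.announcement h
          then tracePair (E h) ((1 - nearProj Pt bt h c.keyPositions k) *
            c.signalState ρ * (1 - nearProj Pt bt h c.keyPositions k)) else 0) ≤
      Fintype.card (ClassicalState p bt) * (2 + θ * (γ + 2 * β) / 2) ^ (2 * p.n) := by
  choose Z hZ₀ hZt hZ using hq.exists_bound hρ
  have h1 := sum_testPositions_keyPositions_le (p := p) (bt := bt)
    (fun A B => ∑ h, tracePair (E h) (weightOp ρ Pt bt h θ A B))
    (2 ^ p.N * (2 + θ * (γ + 2 * β) / 2) ^ (2 * p.n)) (fun T hT => by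
      rw [Finset.sum_comm]
      refine (Finset.sum_le_sum fun h _ =>
        sum_tracePair_weightOp_le hq hρ hθ hθ1 hZ (hE h) bt h T p.n).trans ?_
      rw [← tracePair_sum_left, hE1, tracePair, one_mul, ← hT]
      exact trace_dominating_le hρ hθ hZ₀ hZt bt T)
  have h2N : (0 : ℝ) < 2 ^ p.N := by positivity
  refine le_of_mul_le_mul_left ?_ h2N
  rw [mul_left_comm, mul_left_comm (2 ^ p.N : ℝ), mul_left_comm (2 ^ p.N : ℝ), sum_eq_sum_sum_bits]
  refine le_trans (mul_le_mul_of_nonneg_left ?_ (Nat.cast_nonneg _)) h1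
  rw [Finset.mul_sum]
  refine Finset.sum_le_sum fun c _ => ?_
  rw [Finset.sum_comm, Finset.mul_sum]
  exact Finset.sum_le_sum fun h _ => sum_bits_tail_le hq hρ hθ hθ1 k (hE h) h c

end ClassicalState

/-- The numerical estimate behind the choice `θ = ε / 2`: the gain `θ (q - δ - s / 2)` of first
order exceeds the terms of second order in `θ`. -/
theorem weight_ratio_le {ε δ q s : ℝ} {n k j : ℕ} (hε : 0 < ε) (hε1 : ε ≤ 1 / 2)
    (hq : q ≤ 1 / 2) (hs0 : 0 ≤ s) (hs : δ + s / 2 + 3 / 2 * ε ≤ q)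
    (hj : (j : ℝ) ≤ δ * n) (hk : q * n ≤ k) :
    (1 + ε / 2 * s / 4) ^ (2 * n) ≤
      Real.exp (-(ε ^ 2 / 4) * n) * ((1 - ε / 2) ^ j * (1 + ε / 2) ^ k) := by
  obtain ⟨θ, hθ⟩ : ∃ θ, θ = ε / 2 := ⟨_, rfl⟩
  rw [← hθ]
  have hθ0 : 0 < θ := by rw [hθ]; positivity
  have hθ1 : θ ≤ 1 / 4 := by linarith
  have hn : (0 : ℝ) ≤ n := Nat.cast_nonneg n
  have h1 : (1 + θ * s / 4) ^ (2 * n) ≤ Real.exp (θ * s / 2 * n) := by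
    calc (1 + θ * s / 4) ^ (2 * n) ≤ Real.exp (θ * s / 4) ^ (2 * n) :=
          pow_le_pow_left₀ (by positivity) (by linarith [Real.add_one_le_exp (θ * s / 4)]) _
      _ = Real.exp (θ * s / 2 * n) := by
          rw [← Real.exp_nat_mul]; congr 1; push_cast; ring
  have e1 : Real.exp (-(θ + 2 * θ ^ 2)) ≤ 1 - θ := by
    rw [← Real.le_log_iff_exp_le (by linarith)]
    refine le_trans ?_ (Real.one_sub_inv_le_log_of_pos (by linarith))
    have : (1 - θ)⁻¹ ≤ 1 + θ + 2 * θ ^ 2 := by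
      rw [inv_le_iff_one_le_mul₀ (by linarith)]
      nlinarith [mul_nonneg (sq_nonneg θ) (show 0 ≤ 1 - 2 * θ by linarith)]
    linarith
  have e2 : Real.exp (θ - θ ^ 2) ≤ 1 + θ := by
    rw [← Real.le_log_iff_exp_le (by linarith)]
    refine le_trans ?_ (Real.one_sub_inv_le_log_of_pos (by linarith))
    have : (1 + θ)⁻¹ ≤ 1 - θ + θ ^ 2 := by
      rw [inv_le_iff_one_le_mul₀ (by linarith)]
      nlinarith [pow_pos hθ0 3]
    linarith
  have h2 : Real.exp (-(θ + 2 * θ ^ 2) * (δ * n)) ≤ (1 - θ) ^ j := by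
    refine le_trans ?_ (pow_le_pow_left₀ (Real.exp_pos _).le e1 j)
    rw [← Real.exp_nat_mul, Real.exp_le_exp]
    nlinarith [mul_nonneg (show 0 ≤ θ + 2 * θ ^ 2 by positivity) (sub_nonneg.2 hj)]
  have h3 : Real.exp ((θ - θ ^ 2) * (q * n)) ≤ (1 + θ) ^ k := by
    refine le_trans ?_ (pow_le_pow_left₀ (Real.exp_pos _).le e2 k)
    rw [← Real.exp_nat_mul, Real.exp_le_exp]
    nlinarith [mul_nonneg (show 0 ≤ θ - θ ^ 2 by nlinarith) (sub_nonneg.2 hk)]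
  have h4 := mul_le_mul h2 h3 (Real.exp_pos _).le (pow_nonneg (by linarith) _)
  refine h1.trans (le_trans ?_ (mul_le_mul_of_nonneg_left h4 (Real.exp_pos _).le))
  rw [← Real.exp_add, ← Real.exp_add, Real.exp_le_exp]
  have hε2 : ε = 2 * θ := by linarith
  have h5 : θ * (δ + s / 2 + 3 / 2 * ε) ≤ θ * q := mul_le_mul_of_nonneg_left hs hθ0.le
  have h6 : θ ^ 2 * (q + 2 * δ) ≤ θ ^ 2 * (3 / 2) :=
    mul_le_mul_of_nonneg_left (by linarith) (sq_nonneg _)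
  have h7 : θ * s / 2 ≤ -(ε ^ 2 / 4) + (-(θ + 2 * θ ^ 2) * δ + (θ - θ ^ 2) * q) := by
    rw [hε2] at h5 ⊢
    nlinarith [sq_nonneg θ]
  have := mul_le_mul_of_nonneg_right h7 hn
  linarith

open Classical in
/-- The probability that the validation test is passed although the bits on the key set, measured
in the basis `bt`, are far from the string `h`, is exponentially small. -/
theorem ClassicalState.sum_tail_le_exp {p : Parameters} {bt : Bits p.N} {D : ℕ}
    {ρ P Pt : Source D} {β γ : ℝ} (hq : QuasiperfectWith ρ P Pt β γ)
    (hρ : ∀ a g, IsDensityMatrix (ρ a g)) {q : ℝ} (hε1 : p.ε ≤ 1 / 2) (hq1 : q ≤ 1 / 2)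
    (hqδ : p.δ + β + γ / 2 + 3 / 2 * p.ε ≤ q)
    {E : Bits p.N → SignalOp p D} (hE : ∀ h, (E h).PosSemidef) (hE1 : ∑ h, E h = 1) :
    ∑ c : ClassicalState p bt, ∑ h : Bits p.N, (if PassesTest p bt c.announcement h
          then tracePair (E h) ((1 - nearProj Pt bt h c.keyPositions ⌈q * p.n⌉₊) *
            c.signalState ρ * (1 - nearProj Pt bt h c.keyPositions ⌈q * p.n⌉₊)) else 0) ≤
      Fintype.card (ClassicalState p bt) * (2 * p.n * Real.exp (-(p.ε ^ 2 / 4) * p.n)) := by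
  have hβ := hq.beta_nonneg hρ
  have hγ := hq.gamma_nonneg
  have hε := p.ε_pos
  have hδ := p.δ_pos
  have hn : 0 < p.n := lt_of_le_of_lt (Nat.zero_le _) p.m_lt_n
  have h1 := sum_tail_le (bt := bt) hq hρ (θ := p.ε / 2) (by linarith) (by linarith) ⌈q * p.n⌉₊
    hE hE1
  have h2 := weight_ratio_le (n := p.n) (k := ⌈q * p.n⌉₊) (j := ⌊p.δ * (p.n : ℝ)⌋₊) (δ := p.δ)
    (q := q) (s := γ + 2 * β) hε hε1 hq1 (by linarith) (by linarith)
    (Nat.floor_le (by positivity)) (Nat.le_ceil _)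
  set w := (1 - p.ε / 2) ^ ⌊p.δ * (p.n : ℝ)⌋₊ * (1 + p.ε / 2) ^ ⌈q * p.n⌉₊ with hw
  have hw0 : 0 < w := mul_pos (pow_pos (by linarith) _) (pow_pos (by linarith) _)
  have h3 : (2 + p.ε / 2 * (γ + 2 * β) / 2) ^ (2 * p.n) =
      4 ^ p.n * (1 + p.ε / 2 * (γ + 2 * β) / 4) ^ (2 * p.n) := by
    rw [show (4 : ℝ) = 2 ^ 2 by norm_num, ← pow_mul, ← mul_pow]
    congr 1; ring
  have h4 : (4 : ℝ) ^ p.n ≤ 2 * p.n * Nat.centralBinom p.n := by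
    exact_mod_cast Nat.four_pow_le_two_mul_self_mul_centralBinom p.n hn
  have hcb : (0 : ℝ) < Nat.centralBinom p.n := by exact_mod_cast Nat.centralBinom_pos p.n
  rw [h3] at h1
  refine le_of_mul_le_mul_left ?_ (mul_pos hcb hw0)
  rw [mul_assoc]
  refine h1.trans ?_
  have h5 : (4 : ℝ) ^ p.n * (1 + p.ε / 2 * (γ + 2 * β) / 4) ^ (2 * p.n) ≤
      2 * p.n * Nat.centralBinom p.n * (Real.exp (-(p.ε ^ 2 / 4) * p.n) * w) :=
    mul_le_mul h4 h2 (by positivity) (by positivity)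
  refine (mul_le_mul_of_nonneg_left h5 (Nat.cast_nonneg _)).trans (le_of_eq (by ring))

/-! ### Duality for the code and the privacy amplification -/

/-- If every combination of rows of `F` and `K` in which `K` takes part is heavier than `w`, then
every value of the key is attained on words of syndrome zero that are orthogonal to `w`. -/
theorem exists_word_orthogonal {r m n : ℕ} {F : Matrix (Fin r) (Fin n) (ZMod 2)}
    {K : Matrix (Fin m) (Fin n) (ZMod 2)} {w : Bits n}
    (hw : ∀ (x : Bits r) (y : Bits m), y ≠ 0 →
      hammingNorm w < hammingNorm (Matrix.vecMul x F + Matrix.vecMul y K)) (κ : Bits m) :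
    ∃ ξ : Bits n, F.mulVec ξ = 0 ∧ K.mulVec ξ = κ ∧ ξ ⬝ᵥ w = 0 := by
  let M : Matrix (Fin r ⊕ Fin m ⊕ Unit) (Fin n) (ZMod 2) :=
    Matrix.of (Sum.elim F (Sum.elim K fun _ => w))
  let v : Fin r ⊕ Fin m ⊕ Unit → ZMod 2 := Sum.elim 0 (Sum.elim κ fun _ => 0)
  by_cases hv : v ∈ LinearMap.range M.mulVecLin
  · obtain ⟨ξ, hξ⟩ := hv
    refine ⟨ξ, funext fun i => ?_, funext fun i => ?_, ?_⟩
    · exact congrFun hξ (Sum.inl i)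
    · exact congrFun hξ (Sum.inr (Sum.inl i))
    · rw [dotProduct_comm]
      exact congrFun hξ (Sum.inr (Sum.inr ()))
  exfalso
  obtain ⟨φ, hφv, hφ⟩ := Submodule.exists_le_ker_of_notMem hv
  let f : Fin r ⊕ Fin m ⊕ Unit → ZMod 2 := fun i => φ fun j => if i = j then 1 else 0
  have hf : ∀ u, φ u = f ⬝ᵥ u := fun u => by
    rw [LinearMap.pi_apply_eq_sum_univ φ u, dotProduct]
    exact Finset.sum_congr rfl fun i _ => by rw [smul_eq_mul, mul_comm]
  have hfM : Matrix.vecMul f M = 0 := by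
    refine funext fun j => ?_
    have h1 : φ (M.mulVec (Pi.single j 1)) = 0 := hφ ⟨Pi.single j 1, rfl⟩
    rw [hf, Matrix.dotProduct_mulVec] at h1
    simpa using h1
  have hy : (fun i => f (Sum.inr (Sum.inl i))) ≠ 0 := by
    intro h0
    apply hφv
    rw [hf, dotProduct, Fintype.sum_sum_type, Fintype.sum_sum_type]
    simp [v, fun i => congrFun h0 i]
  have hlt := hw (fun i => f (Sum.inl i)) _ hy
  have he : Matrix.vecMul (fun i => f (Sum.inl i)) F +
      Matrix.vecMul (fun i => f (Sum.inr (Sum.inl i))) K = f (Sum.inr (Sum.inr ())) • w := by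
    funext j
    have := congrFun hfM j
    simp only [Matrix.vecMul, dotProduct, Fintype.sum_sum_type, Pi.zero_apply, M, Matrix.of_apply,
      Finset.univ_unique, Finset.sum_singleton] at this
    rw [← add_assoc, CharTwo.add_eq_zero] at this
    exact this
  rw [he] at hlt
  rcases zmod_two_cases (f (Sum.inr (Sum.inr ()))) with h0 | h0
  · rw [h0, zero_smul, hammingNorm_zero] at hlt
    exact Nat.not_lt_zero _ hlt
  · rw [h0, one_smul] at hlt
    exact lt_irrefl _ hlt

theorem substring_add {N : ℕ} (n : ℕ) (g x : Bits N) (S : Finset (Fin N)) :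
    substring n (g + x) S = substring n g S + substring n x S := by
  funext k
  simp only [substring, Pi.add_apply]
  split_ifs
  · rfl
  · rw [add_zero]

theorem hammingNorm_substring {N n : ℕ} (e : Bits N) {S : Finset (Fin N)} (hS : S.card = n) :
    hammingNorm (substring n e S) = errorCount S e := by
  rw [errorCount]
  conv_rhs => rw [← Finset.map_orderEmbOfFin_univ S hS, Finset.filter_map, Finset.card_map]
  simp only [hammingNorm, substring, dif_pos hS]
  rfl

/-- Every word of length `n` is the substring of a string that vanishes outside `S`. -/
theorem exists_extension {N n : ℕ} {S : Finset (Fin N)} (hS : S.card = n) (ξ : Bits n) :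
    ∃ x : Bits N, (∀ i ∉ S, x i = 0) ∧ substring n x S = ξ := by
  refine ⟨fun i => if hi : i ∈ S then ξ ((S.orderIsoOfFin hS).symm ⟨i, hi⟩) else 0,
    fun i hi => dif_neg hi, funext fun k => ?_⟩
  simp only [substring, dif_pos hS]
  rw [dif_pos (Finset.orderEmbOfFin_mem S hS k)]
  congr 1
  rw [OrderIso.symm_apply_eq]
  exact Subtype.ext (Finset.coe_orderIsoOfFin_apply S hS k).symm

theorem sum_mul_eq_dotProduct_substring {N n : ℕ} {S : Finset (Fin N)} (hS : S.card = n)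
    {x : Bits N} (hx : ∀ i ∉ S, x i = 0) (e : Bits N) :
    ∑ i, x i * e i = substring n x S ⬝ᵥ substring n e S := by
  rw [← Finset.sum_subset (Finset.subset_univ S) fun i _ hi => by rw [hx i hi, zero_mul],
    dotProduct]
  conv_lhs => rw [← Finset.map_orderEmbOfFin_univ S hS, Finset.sum_map]
  simp only [substring, dif_pos hS]
  rfl

theorem errorCount_sub_le {N : ℕ} (S : Finset (Fin N)) (e e' : Bits N) :
    errorCount S (e - e') ≤ errorCount S e + errorCount S e' := by
  refine le_trans (Finset.card_le_card fun i hi => ?_) (Finset.card_union_le _ _)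
  rw [Finset.mem_filter] at hi
  rw [Finset.mem_union, Finset.mem_filter, Finset.mem_filter]
  by_contra hcon
  push Not at hcon
  apply hi.2
  rw [Pi.sub_apply, hcon.1 hi.1, hcon.2 hi.1, sub_zero]

/-- A product of signs is trivial if the supports overlap in an even number of places. -/
theorem prod_sign_eq_one {N : ℕ} {x e e' : Bits N} (h : ∑ i, x i * (e - e') i = 0) :
    ∏ i, (if x i ≠ 0 ∧ e i ≠ e' i then (-1 : ℝ) else 1) = 1 := by
  rw [Finset.prod_ite, Finset.prod_const, Finset.prod_const_one, mul_one]
  apply Even.neg_one_pow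
  rw [← ZMod.natCast_eq_zero_iff_even]
  refine Eq.trans ?_ h
  rw [Finset.card_filter, Nat.cast_sum]
  refine Finset.sum_congr rfl fun i _ => ?_
  rw [Pi.sub_apply]
  generalize x i = a, e i = b, e' i = b'
  revert a b b'
  decide

/-! ### Inside a small sphere the state does not depend on the key -/

namespace ClassicalState

variable {p : Parameters} {bt : Bits p.N} {D : ℕ} {ρ P Pt : Source D} {β γ : ℝ}

open Classical in
/-- The sum of the states of the signals over the classical data that are compatible with the
announcement `y` and the key `κ`. -/
noncomputable def keyState (ρ : Source D) (bt : Bits p.N) (y : Announcement p) (κ : Bits p.m) :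
    SignalOp p D :=
  ∑ c : ClassicalState p bt with c.announcement = y ∧ c.key = κ, c.signalState ρ

theorem announcement_addBits {c : ClassicalState p bt} {x : Bits p.N}
    (hx : ∀ i ∉ c.keyPositions, x i = 0)
    (hF : p.F.mulVec (substring p.n x c.keyPositions) = 0) :
    (addBits x c).announcement = c.announcement := by
  have h1 : (addBits x c).syndrome = c.syndrome := by
    change p.F.mulVec (substring p.n (c.g + x) c.keyPositions) =
      p.F.mulVec (substring p.n c.g c.keyPositions)
    rw [substring_add, Matrix.mulVec_add, hF, add_zero]
  have h2 : ∀ i, (addBits x c).announcement.gOpen i = c.announcement.gOpen i := fun i => by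
    change (if i ∈ c.keyPositions then none else some ((c.g + x) i)) =
      if i ∈ c.keyPositions then none else some (c.g i)
    split_ifs with hi
    · rfl
    · rw [Pi.add_apply, hx i hi, add_zero]
  simp only [announcement] at h2 ⊢
  rw [Announcement.mk.injEq]
  exact ⟨rfl, funext h2, rfl, h1, rfl⟩

theorem key_addBits (c : ClassicalState p bt) (x : Bits p.N) :
    (addBits x c).key = c.key + p.K.mulVec (substring p.n x c.keyPositions) := by
  change p.K.mulVec (substring p.n (c.g + x) c.keyPositions) =
    p.K.mulVec (substring p.n c.g c.keyPositions) + _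
  rw [substring_add, Matrix.mulVec_add]

/-- A change of Alice's bits on the key set multiplies each block of the state by a sign. -/
theorem pattern_signalState_addBits (hq : QuasiperfectWith ρ P Pt β γ)
    (hρ : ∀ a g, IsDensityMatrix (ρ a g)) {c : ClassicalState p bt} {x : Bits p.N}
    (hx : ∀ i ∉ c.keyPositions, x i = 0) (h e e' : Bits p.N) :
    patternProj Pt bt h c.keyPositions e * (addBits x c).signalState ρ *
        patternProj Pt bt h c.keyPositions e' =
      (∏ i, (if x i ≠ 0 ∧ e i ≠ e' i then (-1 : ℝ) else 1)) •
        (patternProj Pt bt h c.keyPositions e * c.signalState ρ *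
          patternProj Pt bt h c.keyPositions e') := by
  simp only [patternProj, signalState]
  rw [tensorMatrix_mul, tensorMatrix_mul, tensorMatrix_mul, tensorMatrix_mul, ← tensorMatrix_smul]
  congr 1
  funext i
  change _ * ρ (c.a i) (c.g i + x i) * _ = _
  by_cases hi : i ∈ c.keyPositions
  · simp only [errorProj, if_pos hi]
    rw [a_of_mem_keySet hi, hq.tilde_state_tilde hρ]
    simp only [ne_eq, add_right_inj]
  · rw [hx i hi, add_zero]
    simp

/-- The projection of the state on a small sphere around `h` does not depend on the key: two
patterns in the sphere differ by a word that is lighter than the words of the dual code that involve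
`K`, so that the key can be changed without changing the corresponding block of the state. -/
theorem near_keyState_eq (hq : QuasiperfectWith ρ P Pt β γ)
    (hρ : ∀ a g, IsDensityMatrix (ρ a g)) {k : ℕ}
    (hk : ∀ (x : Bits p.r) (y : Bits p.m), y ≠ 0 → ∀ l l', l < k → l' < k →
      l + l' < hammingNorm (Matrix.vecMul x p.F + Matrix.vecMul y p.K))
    (y : Announcement p) (h : Bits p.N) (κ κ' : Bits p.m) :
    nearProj Pt bt h (keySet p.n bt y.a y.R y.π) k * keyState ρ bt y κ *
        nearProj Pt bt h (keySet p.n bt y.a y.R y.π) k =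
      nearProj Pt bt h (keySet p.n bt y.a y.R y.π) k * keyState ρ bt y κ' *
        nearProj Pt bt h (keySet p.n bt y.a y.R y.π) k := by
  classical
  by_cases hy : ∃ c : ClassicalState p bt, c.announcement = y
  swap
  · push Not at hy
    simp [keyState, hy]
  obtain ⟨c₀, hc₀⟩ := hy
  have hkey : ∀ c : ClassicalState p bt, c.announcement = y →
      c.keyPositions = keySet p.n bt y.a y.R y.π := by
    rintro c rfl; rfl
  have hS : (keySet p.n bt y.a y.R y.π).card = p.n := hkey c₀ hc₀ ▸ c₀.card_keyPositions
  set S := keySet p.n bt y.a y.R y.π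
  simp only [nearProj, Finset.sum_mul, Finset.mul_sum]
  refine Finset.sum_congr rfl fun e' he' => Finset.sum_congr rfl fun e he => ?_
  obtain ⟨ξ, hF, hK, hdot⟩ := exists_word_orthogonal (w := substring p.n (e - e') S)
    (F := p.F) (K := p.K) (fun a b hb => by
      rw [hammingNorm_substring _ hS]
      exact (errorCount_sub_le S e e').trans_lt
        (hk a b hb _ _ (Finset.mem_filter.1 he).2 (Finset.mem_filter.1 he').2)) (κ' + κ)
  obtain ⟨x, hx, hxξ⟩ := exists_extension hS ξ
  have hsign : ∏ i, (if x i ≠ 0 ∧ e i ≠ e' i then (-1 : ℝ) else 1) = 1 :=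
    prod_sign_eq_one (by rw [sum_mul_eq_dotProduct_substring hS hx, hxξ, hdot])
  have htr : ∀ κ₁ κ₂ : Bits p.m, κ₁ + (κ' + κ) = κ₂ → ∀ c : ClassicalState p bt,
      c.announcement = y ∧ c.key = κ₁ →
      (addBits x c).announcement = y ∧ (addBits x c).key = κ₂ := by
    rintro κ₁ κ₂ hκ c ⟨h1, h2⟩
    rw [← hkey c h1] at hx hxξ
    refine ⟨(announcement_addBits hx (by rw [hxξ, hF])).trans h1, ?_⟩
    rw [key_addBits, hxξ, hK, h2, hκ]
  have hκ₁ : κ + (κ' + κ) = κ' := funext fun i => by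
    simp only [Pi.add_apply]; rw [add_left_comm, CharTwo.add_self_eq_zero, add_zero]
  have hκ₂ : κ' + (κ' + κ) = κ := funext fun i => by
    simp only [Pi.add_apply]; rw [← add_assoc, CharTwo.add_self_eq_zero, zero_add]
  simp only [keyState, Finset.sum_mul, Finset.mul_sum]
  refine Finset.sum_nbij' (addBits x) (addBits x) (fun c hc => ?_) (fun c hc => ?_)
    (fun c _ => addBits_addBits x c) (fun c _ => addBits_addBits x c) fun c hc => ?_
  · exact Finset.mem_filter.2 ⟨Finset.mem_univ _, htr _ _ hκ₁ c (Finset.mem_filter.1 hc).2⟩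
  · exact Finset.mem_filter.2 ⟨Finset.mem_univ _, htr _ _ hκ₂ c (Finset.mem_filter.1 hc).2⟩
  · have h1 := hkey c (Finset.mem_filter.1 hc).2.1
    rw [← h1] at hx ⊢
    rw [pattern_signalState_addBits hq hρ hx, hsign, one_smul]

end ClassicalState

/-! ### Probabilities of a normalized attack -/

section Born

variable {p : Parameters} {bt : Bits p.N} {D : ℕ} {ρ : Source D}

open Classical in
/-- A measurement of the classical data followed by `E` on the signals is an average over the
classical data. -/
theorem bornProb_classicalProj (B : ClassicalState p bt → Prop) (E : SignalOp p D) :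
    bornProb p bt ρ (classicalProj B ⊗ₖ E) =
      (Fintype.card (ClassicalState p bt) : ℝ)⁻¹ * ∑ c with B c, tracePair E (c.signalState ρ) := by
  rw [bornProb, systemState, Matrix.mul_sum, Matrix.trace_sum, Complex.re_sum, Finset.mul_sum,
    Finset.sum_filter]
  refine Finset.sum_congr rfl fun c _ => ?_
  rw [Matrix.mul_smul, ← Matrix.mul_kronecker_mul, Matrix.trace_smul, Matrix.trace_kronecker,
    classicalProj, Matrix.trace_mul_comm, Matrix.trace_single_mul]
  split_ifs with h
  · simp [h, tracePair, ClassicalState.signalState, ← Complex.ofReal_natCast,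
      ← Complex.ofReal_inv]
  · simp [h]

theorem bornProb_sum {κ : Type*} (s : Finset κ) (F : κ → SystemOp p bt D) :
    bornProb p bt ρ (∑ k ∈ s, F k) = ∑ k ∈ s, bornProb p bt ρ (F k) := by
  simp only [bornProb, Finset.sum_mul, Matrix.trace_sum, Complex.re_sum]

theorem bornProb_one [Nonempty (ClassicalState p bt)] (hρ : ∀ a g, IsDensityMatrix (ρ a g)) :
    bornProb p bt ρ (1 : SystemOp p bt D) = 1 := by
  classical
  have h1 : (1 : SystemOp p bt D) = classicalProj (fun _ => True) ⊗ₖ (1 : SignalOp p D) := by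
    rw [classicalProj]
    simp only [if_true, Matrix.diagonal_one, Matrix.one_kronecker_one]
  have h2 : ∀ c : ClassicalState p bt, tracePair 1 (c.signalState ρ) = 1 := fun c => by
    rw [tracePair, one_mul, ClassicalState.signalState, trace_tensorMatrix,
      Finset.prod_congr rfl fun i _ => (hρ (c.a i) (c.g i)).2]
    simp
  rw [h1, bornProb_classicalProj, Finset.sum_congr rfl fun c _ => h2 c]
  simp

end Born

namespace NormalizedAttack

variable {D : ℕ} {p : Parameters} {ρ P Pt : Source D} {bt : Bits p.N} {J : Type*} {β γ : ℝ}

theorem nonempty_classicalState (A : NormalizedAttack p ρ bt J) :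
    Nonempty (ClassicalState p bt) := by
  classical
  obtain ⟨v, hv, _⟩ := Finset.exists_ne_zero_of_sum_ne_zero A.test_pos.ne'
  obtain ⟨c, _⟩ := A.possible v (Finset.mem_filter.1 hv).1
  exact ⟨c⟩

open Classical in
/-- Whatever the classical data are, the part of the attack that announces the string `h` is one
and the same measurement operator. -/
theorem exists_operator_of_string (A : NormalizedAttack p ρ bt J) :
    ∃ Eh : Bits p.N → SignalOp p D, (∀ h, (Eh h).PosSemidef) ∧ ∑ h, Eh h = 1 ∧
      ∀ (c : ClassicalState p bt) h,
        ∑ v ∈ A.views with v.2.1 = h ∧ v.1 = c.announcement, A.E v = Eh h := by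
  choose Eh hpos hsum using A.measure_first
  -- the block of an operator on the complete space that belongs to the classical data `c`
  have hblock : ∀ (c : ClassicalState p bt) h,
      ∑ v ∈ A.views with v.2.1 = h ∧ v.1 = c.announcement, A.E v = Eh h := by
    intro c h
    ext x y
    have h1 := congrFun (congrFun (hsum h) (c, x)) (c, y)
    rw [Matrix.sum_apply, Matrix.kronecker_apply, Matrix.one_apply_eq, one_mul] at h1
    rw [← h1, Matrix.sum_apply, ← Finset.filter_filter, Finset.sum_filter]
    refine Finset.sum_congr rfl fun v hv => ?_
    rw [A.F_eq v (Finset.mem_filter.1 hv).1, Matrix.kronecker_apply, classicalProj,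
      Matrix.diagonal_apply_eq]
    simp only [eq_comm (a := v.1), ite_mul, one_mul, zero_mul]
  refine ⟨Eh, hpos, ?_, hblock⟩
  obtain ⟨c⟩ := A.nonempty_classicalState
  have h1 : ∑ h, ∑ v ∈ A.views with v.2.1 = h, A.F v = 1 := by
    rw [Finset.sum_fiberwise, A.povm.2]
  ext x y
  have h2 := congrFun (congrFun h1 (c, x)) (c, y)
  rw [Finset.sum_congr rfl fun h _ => hsum h, Matrix.sum_apply] at h2
  rw [Matrix.sum_apply]
  simpa [Matrix.kronecker_apply, Matrix.one_apply] using h2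

theorem sum_viewProb (A : NormalizedAttack p ρ bt J) (hρ : ∀ a g, IsDensityMatrix (ρ a g)) :
    ∑ v ∈ A.views, A.viewProb v = 1 := by
  have := A.nonempty_classicalState
  rw [← bornProb_one (p := p) (bt := bt) hρ, ← A.povm.2, bornProb_sum]
  rfl

theorem jointProb_of_passesTest (A : NormalizedAttack p ρ bt J) {v : View p J}
    (hv : PassesTest p bt v.1 v.2.1) (κ : Bits p.m) :
    A.jointProb κ v = (Fintype.card (ClassicalState p bt) : ℝ)⁻¹ *
      tracePair (A.E v) (ClassicalState.keyState ρ bt v.1 κ) := by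
  classical
  rw [jointProb, if_pos hv, bornProb_classicalProj, ClassicalState.keyState, tracePair_sum]
  congr!

theorem sum_jointProb (A : NormalizedAttack p ρ bt J) {v : View p J} (hv : v ∈ A.views) :
    ∑ κ, A.jointProb κ v = A.viewProb v := by
  classical
  by_cases hp : PassesTest p bt v.1 v.2.1
  · rw [viewProb, A.F_eq v hv, bornProb_classicalProj]
    simp only [A.jointProb_of_passesTest hp]
    rw [← Finset.mul_sum, ← Finset.sum_fiberwise _ (fun c => ClassicalState.key c)]
    congr 1
    refine Finset.sum_congr rfl fun κ _ => ?_
    rw [ClassicalState.keyState, tracePair_sum, Finset.filter_filter]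
  · simp only [jointProb, if_neg hp]
    rw [Finset.sum_const, Finset.card_univ, nsmul_eq_mul]
    simp [ZMod.card]

theorem jointProb_nonneg (A : NormalizedAttack p ρ bt J) (hρ : ∀ a g, IsDensityMatrix (ρ a g))
    {v : View p J} (hv : v ∈ A.views) (κ : Bits p.m) : 0 ≤ A.jointProb κ v := by
  classical
  by_cases hp : PassesTest p bt v.1 v.2.1
  · rw [A.jointProb_of_passesTest hp]
    exact mul_nonneg (by positivity) (tracePair_nonneg (A.E_pos v hv)
      (Matrix.posSemidef_sum _ fun c _ => c.posSemidef_signalState hρ))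
  · rw [jointProb, if_neg hp]
    exact mul_nonneg (by positivity) (A.prob_pos v hv).le

/-- The weight of the view `v` and the key `κ` on bits of the key set that are far from the
announced string. -/
noncomputable def farProb (A : NormalizedAttack p ρ bt J) (Pt : Source D) (k : ℕ)
    (κ : Bits p.m) (v : View p J) : ℝ :=
  (Fintype.card (ClassicalState p bt) : ℝ)⁻¹ * tracePair (A.E v)
    ((1 - nearProj Pt bt v.2.1 (keySet p.n bt v.1.a v.1.R v.1.π) k) *
      ClassicalState.keyState ρ bt v.1 κ *
      (1 - nearProj Pt bt v.2.1 (keySet p.n bt v.1.a v.1.R v.1.π) k))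

theorem posSemidef_keyState (hρ : ∀ a g, IsDensityMatrix (ρ a g)) (y : Announcement p)
    (κ : Bits p.m) : (ClassicalState.keyState ρ bt y κ).PosSemidef :=
  Matrix.posSemidef_sum _ fun c _ => c.posSemidef_signalState hρ

open Classical in
/-- Summed over the keys and the views that pass the test, the far weight is a probability in which
only the measurement of the string `h` enters. -/
theorem sum_farProb_eq (A : NormalizedAttack p ρ bt J) (Pt : Source D) (k : ℕ)
    {Eh : Bits p.N → SignalOp p D}
    (hEh : ∀ (c : ClassicalState p bt) h,
      ∑ v ∈ A.views with v.2.1 = h ∧ v.1 = c.announcement, A.E v = Eh h) :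
    ∑ v ∈ A.views with PassesTest p bt v.1 v.2.1, ∑ κ, A.farProb Pt k κ v =
      (Fintype.card (ClassicalState p bt) : ℝ)⁻¹ *
        ∑ c : ClassicalState p bt, ∑ h : Bits p.N, (if PassesTest p bt c.announcement h
          then tracePair (Eh h) ((1 - nearProj Pt bt h c.keyPositions k) *
            c.signalState ρ * (1 - nearProj Pt bt h c.keyPositions k)) else 0) := by
  have h1 : ∀ v : View p J, ∑ κ, A.farProb Pt k κ v =
      (Fintype.card (ClassicalState p bt) : ℝ)⁻¹ *
      ∑ c : ClassicalState p bt, if v.1 = c.announcement then tracePair (A.E v)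
        ((1 - nearProj Pt bt v.2.1 c.keyPositions k) * c.signalState ρ *
        (1 - nearProj Pt bt v.2.1 c.keyPositions k)) else 0 := by
    intro v
    simp only [farProb]
    rw [← Finset.mul_sum, ← Finset.sum_filter,
      ← Finset.sum_fiberwise _ (fun c => ClassicalState.key c)]
    congr 1
    refine Finset.sum_congr rfl fun κ _ => ?_
    rw [ClassicalState.keyState, Finset.mul_sum, Finset.sum_mul, tracePair_sum,
      Finset.filter_filter]
    simp only [eq_comm (a := v.1)]
    refine Finset.sum_congr rfl fun c hc => ?_
    rw [← (Finset.mem_filter.1 hc).2.1]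
    rfl
  rw [Finset.sum_congr rfl fun v _ => h1 v, ← Finset.mul_sum, Finset.sum_comm]
  congr 1
  refine Finset.sum_congr rfl fun c _ => ?_
  rw [← Finset.sum_fiberwise _ fun v : View p J => v.2.1]
  refine Finset.sum_congr rfl fun h _ => ?_
  rw [← hEh c h, Finset.filter_filter, ← Finset.sum_filter, Finset.filter_filter]
  split_ifs with hp
  · rw [tracePair_sum_left]
    refine Finset.sum_congr (Finset.filter_congr fun v _ => ?_) fun v hv => ?_
    · constructor
      · rintro ⟨⟨_, h2⟩, h3⟩
        exact ⟨h2, h3⟩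
      · rintro ⟨h2, h3⟩
        exact ⟨⟨by rw [h2, h3]; exact hp, h2⟩, h3⟩
    · rw [(Finset.mem_filter.1 hv).2.1]
  · refine Finset.sum_eq_zero fun v hv => absurd ?_ hp
    obtain ⟨⟨h2, h3⟩, h4⟩ := (Finset.mem_filter.1 hv).2
    rwa [← h3, ← h4]

/-- A view that passes the test gives a nearly uniform key, up to its far weight. -/
theorem sum_abs_jointProb_sub_le (A : NormalizedAttack p ρ bt J)
    (hq : QuasiperfectWith ρ P Pt β γ) (hρ : ∀ a g, IsDensityMatrix (ρ a g)) {k : ℕ}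
    (hk : ∀ (x : Bits p.r) (y : Bits p.m), y ≠ 0 → ∀ l l', l < k → l' < k →
      l + l' < hammingNorm (Matrix.vecMul x p.F + Matrix.vecMul y p.K))
    {v : View p J} (hv : v ∈ A.views) (hp : PassesTest p bt v.1 v.2.1) {η : ℝ} (hη : 0 < η) :
    ∑ κ, |A.jointProb κ v - ((2 : ℝ) ^ p.m)⁻¹ * A.viewProb v| ≤
      2 * (2 * η * A.viewProb v + (2 * η + 1 + η⁻¹) * ∑ κ, A.farProb Pt k κ v) := by
  set ν := (Fintype.card (ClassicalState p bt) : ℝ)⁻¹ with hν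
  have hν0 : 0 ≤ ν := by positivity
  set Q := nearProj Pt bt v.2.1 (keySet p.n bt v.1.a v.1.R v.1.π) k with hQ
  have hQh : Q.IsHermitian := isHermitian_nearProj hq k
  set u := ν * tracePair (A.E v) (Q * ClassicalState.keyState ρ bt v.1 0 * Q) with hu
  have hκ : ∀ κ, u = ν * tracePair (A.E v) (Q * ClassicalState.keyState ρ bt v.1 κ * Q) :=
    fun κ => by
      rw [hu, hQ, ClassicalState.near_keyState_eq hq hρ hk v.1 v.2.1 0 κ]
  have h1 : ∀ κ, |A.jointProb κ v - u| ≤ η * u + (1 + η⁻¹) * A.farProb Pt k κ v := fun κ => by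
    have := mul_le_mul_of_nonneg_left (abs_tracePair_sub_block_le (A.E_pos v hv)
      (posSemidef_keyState (bt := bt) hρ v.1 κ) hQh hη) hν0
    rw [A.jointProb_of_passesTest hp, hκ κ, farProb, ← mul_sub, abs_mul, abs_of_nonneg hν0]
    linarith
  have h2 : ∀ κ, u ≤ 2 * A.jointProb κ v + 2 * A.farProb Pt k κ v := fun κ => by
    have := mul_le_mul_of_nonneg_left (tracePair_block_le (A.E_pos v hv)
      (posSemidef_keyState (bt := bt) hρ v.1 κ) hQh) hν0
    rw [A.jointProb_of_passesTest hp, hκ κ, farProb]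
    linarith
  set M : ℝ := (2 : ℝ) ^ p.m with hM
  have hM0 : 0 < M := by positivity
  have hcard : (Fintype.card (Bits p.m) : ℝ) = M := by simp [hM, ZMod.card]
  set t := ∑ κ, A.farProb Pt k κ v with ht
  set V := A.viewProb v
  have hsumP : ∑ κ, A.jointProb κ v = V := A.sum_jointProb hv
  have h3 : ∑ κ, |A.jointProb κ v - u| ≤ η * (M * u) + (1 + η⁻¹) * t := by
    refine (Finset.sum_le_sum fun κ _ => h1 κ).trans (le_of_eq ?_)
    rw [Finset.sum_add_distrib, Finset.sum_const, Finset.card_univ, nsmul_eq_mul, hcard,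
      ← Finset.mul_sum]
    ring
  have h4 : M * u ≤ 2 * V + 2 * t := by
    have := Finset.sum_le_sum fun κ (_ : κ ∈ Finset.univ) => h2 κ
    rwa [Finset.sum_const, Finset.card_univ, nsmul_eq_mul, hcard, Finset.sum_add_distrib,
      ← Finset.mul_sum, ← Finset.mul_sum, hsumP] at this
  have h5 : |V - M * u| ≤ ∑ κ, |A.jointProb κ v - u| := by
    refine le_trans (le_of_eq ?_) (Finset.abs_sum_le_sum_abs _ _)
    rw [Finset.sum_sub_distrib, hsumP, Finset.sum_const, Finset.card_univ, nsmul_eq_mul, hcard]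
  have h6 : ∑ κ, |A.jointProb κ v - M⁻¹ * V| ≤ 2 * ∑ κ, |A.jointProb κ v - u| := by
    calc ∑ κ, |A.jointProb κ v - M⁻¹ * V|
        ≤ ∑ κ, (|A.jointProb κ v - u| + M⁻¹ * |V - M * u|) := by
          refine Finset.sum_le_sum fun κ _ => ?_
          have : A.jointProb κ v - M⁻¹ * V =
              (A.jointProb κ v - u) - M⁻¹ * (V - M * u) := by
            field_simp
            ring
          rw [this]
          refine (abs_sub _ _).trans (le_of_eq ?_)
          rw [abs_mul, abs_of_pos (inv_pos.2 hM0)]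
      _ = ∑ κ, |A.jointProb κ v - u| + |V - M * u| := by
          rw [Finset.sum_add_distrib, Finset.sum_const, Finset.card_univ, nsmul_eq_mul, hcard,
            mul_inv_cancel_left₀ hM0.ne']
      _ ≤ _ := by linarith
  have h7 := mul_le_mul_of_nonneg_left h4 hη.le
  refine h6.trans ?_
  linarith

end NormalizedAttack

/-! ### Entropy -/

/-- The loss of entropy is linear in the distance from the uniform distribution: for
`f = 2 ^ m p / V`, which is at most `2 ^ m`, one has `f log₂ f ≤ (f - 1) (m + 2)` if `f ≥ 1`. -/
theorem mul_logb_div_le {m : ℕ} {x V : ℝ} (hx : 0 ≤ x) (hxV : x ≤ V) (hV : 0 < V) :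
    x * Real.logb 2 (x / V) ≤
      -(m : ℝ) * x + (m + 2) * |x - ((2 : ℝ) ^ m)⁻¹ * V| := by
  rcases hx.eq_or_lt with rfl | hx0
  · simp only [zero_mul, mul_zero, zero_add]
    positivity
  have hM : (0 : ℝ) < 2 ^ m := by positivity
  set f := 2 ^ m * (x / V) with hf
  have hf0 : 0 < f := by positivity
  have hxf : x = (2 ^ m)⁻¹ * V * f := by rw [hf]; field_simp
  have hc : 0 < ((2 : ℝ) ^ m)⁻¹ * V := by positivity
  have hlog : Real.logb 2 (x / V) = Real.logb 2 f - m := by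
    rw [hf, Real.logb_mul hM.ne' (by positivity), Real.logb_pow, Real.logb_self_eq_one one_lt_two]
    ring
  have hdist : |x - ((2 : ℝ) ^ m)⁻¹ * V| = (2 ^ m)⁻¹ * V * |f - 1| := by
    conv_lhs => rw [hxf]
    rw [← mul_sub_one, abs_mul, abs_of_pos hc]
  have key : f * Real.logb 2 f ≤ (m + 2) * |f - 1| := by
    rcases le_total f 1 with h1 | h1
    · have : Real.logb 2 f ≤ 0 := Real.logb_nonpos one_lt_two hf0.le h1
      have h2 : f * Real.logb 2 f ≤ 0 := mul_nonpos_of_nonneg_of_nonpos hf0.le this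
      have h3 : (0 : ℝ) ≤ (m + 2) * |f - 1| := by positivity
      linarith
    · rw [abs_of_nonneg (sub_nonneg.2 h1)]
      have hlm : Real.logb 2 f ≤ m := by
        rw [Real.logb_le_iff_le_rpow one_lt_two hf0, Real.rpow_natCast, hf]
        have : x / V ≤ 1 := (div_le_one hV).2 hxV
        nlinarith
      have hl2 : Real.logb 2 f ≤ 2 * (f - 1) := by
        rw [Real.logb, div_le_iff₀ (Real.log_pos one_lt_two)]
        have h2 := Real.log_le_sub_one_of_pos hf0
        have h3 := Real.log_two_gt_d9
        nlinarith [sub_nonneg.2 h1]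
      nlinarith [mul_le_mul_of_nonneg_left hlm (sub_nonneg.2 h1)]
  rw [hlog, hdist, mul_sub]
  have h4 := mul_le_mul_of_nonneg_left key hc.le
  have h5 : x * Real.logb 2 f = (2 ^ m)⁻¹ * V * (f * Real.logb 2 f) := by
    conv_lhs => rw [hxf]
    ring
  rw [h5]
  linarith

namespace NormalizedAttack

variable {D : ℕ} {p : Parameters} {ρ P Pt : Source D} {bt : Bits p.N} {J : Type*} {β γ : ℝ}

open Classical in
/-- Only the views that pass the test lose entropy: otherwise the key is uniform by definition. -/
theorem le_condEntropy (A : NormalizedAttack p ρ bt J) (hρ : ∀ a g, IsDensityMatrix (ρ a g)) :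
    (p.m : ℝ) - (p.m + 2) * ∑ v ∈ A.views with PassesTest p bt v.1 v.2.1,
      ∑ κ, |A.jointProb κ v - ((2 : ℝ) ^ p.m)⁻¹ * A.viewProb v| ≤ A.condEntropy := by
  have h1 : ∀ v ∈ A.views,
      ∑ κ, A.jointProb κ v * Real.logb 2 (A.jointProb κ v / A.viewProb v) ≤
      -(p.m : ℝ) * A.viewProb v + (p.m + 2) * if PassesTest p bt v.1 v.2.1 then
        ∑ κ, |A.jointProb κ v - ((2 : ℝ) ^ p.m)⁻¹ * A.viewProb v| else 0 := by
    intro v hv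
    have hnn := fun κ => A.jointProb_nonneg hρ hv κ
    have hle : ∀ κ, A.jointProb κ v ≤ A.viewProb v := fun κ => by
      rw [← A.sum_jointProb hv]
      exact Finset.single_le_sum (f := fun κ => A.jointProb κ v) (fun κ _ => hnn κ)
        (Finset.mem_univ κ)
    refine (Finset.sum_le_sum fun κ _ =>
      mul_logb_div_le (m := p.m) (hnn κ) (hle κ) (A.prob_pos v hv)).trans (le_of_eq ?_)
    rw [Finset.sum_add_distrib, ← Finset.mul_sum, ← Finset.mul_sum, A.sum_jointProb hv]
    congr 2
    split_ifs with hp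
    · rfl
    · refine Finset.sum_eq_zero fun κ _ => ?_
      rw [jointProb, if_neg hp, sub_self, abs_zero]
  have h2 := Finset.sum_le_sum h1
  rw [Finset.sum_add_distrib, ← Finset.mul_sum, ← Finset.mul_sum, A.sum_viewProb hρ, mul_one,
    ← Finset.sum_filter] at h2
  rw [condEntropy, Finset.sum_comm (s := Finset.univ) (t := A.views)]
  linarith

end NormalizedAttack

/-! ### Security -/

variable {p : Parameters} {D : ℕ} {ρ P Pt : Source D} {β γ lam : ℝ}

/-- The error rate up to which bits on the key set count as near exceeds the error rate `δ` of the
test by an amount that covers the imperfections of the source and the sampling. -/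
theorem Conditions.margin (hc : Conditions p β γ lam) (hβ : 0 ≤ β) :
    p.δ + β + γ / 2 + 3 / 2 * p.ε ≤ 1 / (1 - lam) * p.δ + γ / 2 + p.ε := by
  have h1 := hc.lam_spec
  have hne : 1 - lam ≠ 0 := by
    intro h0
    rw [h0, div_zero, zero_mul] at h1
    linarith [p.ε_pos]
  have : 1 / (1 - lam) = 1 + lam / (1 - lam) := by
    field_simp
    ring
  rw [this, add_mul, one_mul]
  linarith

theorem Conditions.rate_le_half (hc : Conditions p β γ lam) (hm : 0 < p.m) :
    1 / (1 - lam) * p.δ + γ / 2 + p.ε ≤ 1 / 2 := by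
  have hn : (0 : ℝ) < p.n := by exact_mod_cast lt_of_le_of_lt (Nat.zero_le _) p.m_lt_n
  have h1 := hc.weight 0 (Pi.single ⟨0, hm⟩ 1) (by
    intro h0
    simpa using congrFun h0 ⟨0, hm⟩)
  have h2 : (hammingNorm (Matrix.vecMul 0 p.F +
      Matrix.vecMul (Pi.single ⟨0, hm⟩ 1) p.K) : ℝ) ≤ p.n := by
    exact_mod_cast (hammingNorm_le_card_fintype).trans (Fintype.card_fin _).le
  have h3 := le_of_mul_le_mul_right (h1.trans (by linarith : _ ≤ 1 * (p.n : ℝ))) hn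
  linarith

theorem Conditions.lt_hammingNorm (hc : Conditions p β γ lam) (x : Bits p.r) (y : Bits p.m)
    (hy : y ≠ 0) (l l' : ℕ) (hl : l < ⌈(1 / (1 - lam) * p.δ + γ / 2 + p.ε) * (p.n : ℝ)⌉₊)
    (hl' : l' < ⌈(1 / (1 - lam) * p.δ + γ / 2 + p.ε) * (p.n : ℝ)⌉₊) :
    l + l' < hammingNorm (Matrix.vecMul x p.F + Matrix.vecMul y p.K) := by
  rw [Nat.lt_ceil] at hl hl'
  have := hc.weight x y hy
  have h : ((l + l' : ℕ) : ℝ) < hammingNorm (Matrix.vecMul x p.F + Matrix.vecMul y p.K) := by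
    push_cast
    linarith
  exact_mod_cast h

/-- The total far weight of the views that pass the test is exponentially small. -/
theorem NormalizedAttack.sum_farProb_le (hq : QuasiperfectWith ρ P Pt β γ)
    (hρ : ∀ a g, IsDensityMatrix (ρ a g)) {bt : Bits p.N} {J : Type*}
    (A : NormalizedAttack p ρ bt J) {q : ℝ} (hε1 : p.ε ≤ 1 / 2) (hq1 : q ≤ 1 / 2)
    (hqδ : p.δ + β + γ / 2 + 3 / 2 * p.ε ≤ q) :
    open Classical in
    ∑ v ∈ A.views with PassesTest p bt v.1 v.2.1, ∑ κ, A.farProb Pt ⌈q * p.n⌉₊ κ v ≤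
      2 * p.n * Real.exp (-(p.ε ^ 2 / 8) * p.n) ^ 2 := by
  obtain ⟨Eh, hEh, hEh1, hEhc⟩ := A.exists_operator_of_string
  have hT := ClassicalState.sum_tail_le_exp (bt := bt) hq hρ hε1 hq1 hqδ hEh hEh1
  have hcard : (0 : ℝ) < Fintype.card (ClassicalState p bt) := by
    have := A.nonempty_classicalState
    exact_mod_cast Fintype.card_pos
  rw [A.sum_farProb_eq Pt ⌈q * p.n⌉₊ hEhc, inv_mul_le_iff₀ hcard]
  refine hT.trans (le_of_eq ?_)
  rw [← Real.exp_nat_mul]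
  congr 3
  push_cast
  ring

open Classical in
/-- Given the test is passed, the key is close to uniform and independent of the view. -/
theorem NormalizedAttack.sum_sum_abs_jointProb_sub_le (hq : QuasiperfectWith ρ P Pt β γ)
    (hρ : ∀ a g, IsDensityMatrix (ρ a g)) (hc : Conditions p β γ lam) {bt : Bits p.N}
    {J : Type*} (A : NormalizedAttack p ρ bt J) (hm : 0 < p.m) :
    ∑ v ∈ A.views with PassesTest p bt v.1 v.2.1,
      ∑ κ, |A.jointProb κ v - ((2 : ℝ) ^ p.m)⁻¹ * A.viewProb v| ≤
      8 * (2 * p.n + 1) * Real.exp (-(p.ε ^ 2 / 8) * p.n) := by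
  have hβ := hq.beta_nonneg hρ
  have hγ := hq.gamma_nonneg
  have hmargin := hc.margin hβ
  have hq1 := hc.rate_le_half hm
  have hk := hc.lt_hammingNorm
  generalize 1 / (1 - lam) * p.δ + γ / 2 + p.ε = q at hmargin hq1 hk
  have hTle := A.sum_farProb_le hq hρ (q := q) (by linarith [p.δ_pos, p.ε_pos]) hq1 hmargin
  obtain ⟨η, hη⟩ : ∃ η, η = Real.exp (-(p.ε ^ 2 / 8) * p.n) := ⟨_, rfl⟩
  rw [← hη] at hTle ⊢
  have hη0 : 0 < η := hη ▸ Real.exp_pos _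
  have hη1 : η ≤ 1 := hη ▸ Real.exp_le_one_iff.2 (by
    rw [neg_mul, neg_nonpos]; positivity)
  have hn0 : (0 : ℝ) ≤ p.n := Nat.cast_nonneg _
  have hV : ∑ v ∈ A.views with PassesTest p bt v.1 v.2.1, A.viewProb v ≤ 1 := by
    rw [← A.sum_viewProb hρ]
    exact Finset.sum_le_sum_of_subset_of_nonneg (Finset.filter_subset _ _)
      fun v hv _ => (A.prob_pos v hv).le
  refine (Finset.sum_le_sum fun v hv => A.sum_abs_jointProb_sub_le hq hρ hk
    (Finset.mem_filter.1 hv).1 (Finset.mem_filter.1 hv).2 hη0).trans ?_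
  rw [← Finset.mul_sum, Finset.sum_add_distrib, ← Finset.mul_sum, ← Finset.mul_sum]
  generalize ∑ v ∈ A.views with PassesTest p bt v.1 v.2.1, ∑ κ, A.farProb Pt ⌈q * p.n⌉₊ κ v = T
    at hTle ⊢
  have h1 : (2 * η + 1 + η⁻¹) * T ≤ 8 * p.n * η := by
    calc (2 * η + 1 + η⁻¹) * T ≤ (2 * η + 1 + η⁻¹) * (2 * p.n * η ^ 2) :=
          mul_le_mul_of_nonneg_left hTle (by positivity)
      _ = 2 * p.n * η * (2 * η ^ 2 + η + 1) := by field_simp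
      _ ≤ 2 * p.n * η * 4 := by
          refine mul_le_mul_of_nonneg_left ?_ (by positivity)
          nlinarith
      _ = 8 * p.n * η := by ring
  have h2 := mul_le_mul_of_nonneg_left hV (by positivity : 0 ≤ 2 * η)
  linarith

/-- The bound on the conditional entropy with the explicit constant. -/
theorem NormalizedAttack.condEntropy_ge (hq : QuasiperfectWith ρ P Pt β γ)
    (hρ : ∀ a g, IsDensityMatrix (ρ a g)) (hc : Conditions p β γ lam) {bt : Bits p.N}
    {J : Type*} (A : NormalizedAttack p ρ bt J) :
    (p.m : ℝ) - 8 * (p.m + 2) * (2 * p.n + 1) * Real.exp (-(p.ε ^ 2 / 8) * p.n) ≤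
      A.condEntropy := by
  classical
  refine le_trans ?_ (A.le_condEntropy hρ)
  suffices h : ∑ v ∈ A.views with PassesTest p bt v.1 v.2.1,
      ∑ κ, |A.jointProb κ v - ((2 : ℝ) ^ p.m)⁻¹ * A.viewProb v| ≤
        8 * (2 * p.n + 1) * Real.exp (-(p.ε ^ 2 / 8) * p.n) by
    have := mul_le_mul_of_nonneg_left h (by positivity : (0 : ℝ) ≤ p.m + 2)
    linarith
  rcases Nat.eq_zero_or_pos p.m with hm | hm
  · -- for a key of length zero the joint probability is the probability of the view
    refine le_trans (le_of_eq (Finset.sum_eq_zero fun v hv => ?_)) (by positivity :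
      (0 : ℝ) ≤ 8 * (2 * p.n + 1) * Real.exp (-(p.ε ^ 2 / 8) * p.n))
    have : IsEmpty (Fin p.m) := by rw [hm]; infer_instance
    have h1 := A.sum_jointProb (Finset.mem_filter.1 hv).1
    rw [Fintype.sum_unique] at h1 ⊢
    rw [h1, hm]
    simp
  · exact A.sum_sum_abs_jointProb_sub_le hq hρ hc hm

/-- The constant `C` for the exponential decay, from `1 + x ≤ exp x`. -/
theorem polynomial_mul_exp_le {ε l : ℝ} (hε : 0 < ε) (hl : 0 < l) {n m : ℕ}
    (hmn : (m : ℝ) ≤ l * n) :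
    8 * ((m : ℝ) + 2) * (2 * n + 1) * Real.exp (-(ε ^ 2 / 8) * n) ≤
      8 * (l / (ε ^ 2 / 32) + 2) * (2 / (ε ^ 2 / 32) + 1) * Real.exp (-(ε ^ 2 / 16) * n) := by
  set a := ε ^ 2 / 32 with ha
  have ha0 : 0 < a := by positivity
  have hn : (0 : ℝ) ≤ n := Nat.cast_nonneg n
  have h1 : a * n ≤ Real.exp (a * n) := by linarith [Real.add_one_le_exp (a * n)]
  have h2 : 1 ≤ Real.exp (a * n) := Real.one_le_exp (by positivity)
  have h3 : (n : ℝ) ≤ a⁻¹ * Real.exp (a * n) := by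
    rwa [inv_mul_eq_div, le_div_iff₀ ha0, mul_comm]
  have h4 : (m : ℝ) + 2 ≤ (l / a + 2) * Real.exp (a * n) := by
    have := mul_le_mul_of_nonneg_left h3 hl.le
    rw [add_mul, div_eq_mul_inv]
    linarith
  have h5 : 2 * (n : ℝ) + 1 ≤ (2 / a + 1) * Real.exp (a * n) := by
    rw [add_mul, div_eq_mul_inv]
    linarith
  have h6 := mul_le_mul h4 h5 (by positivity) (by positivity)
  have h7 : Real.exp (-(ε ^ 2 / 16) * n) =
      Real.exp (a * n) * Real.exp (a * n) * Real.exp (-(ε ^ 2 / 8) * n) := by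
    rw [← Real.exp_add, ← Real.exp_add]
    congr 1
    rw [ha]
    ring
  have h8 := mul_le_mul_of_nonneg_right h6 (Real.exp_pos (-(ε ^ 2 / 8) * n)).le
  rw [h7]
  linarith

end BB84

theorem mainTheorem8 :
    ∃ (ε₁ : ℕ → ℕ → ℝ → ℝ) (N₀ : ℝ → ℕ),
      (∀ ε : ℝ, 0 < ε → ∀ lam : ℝ, 0 < lam →
        ∃ μ : ℝ, 0 < μ ∧ ∃ C : ℝ, 0 < C ∧ ∀ n m : ℕ, (m : ℝ) ≤ lam * (n : ℝ) →
          0 < ε₁ n m ε ∧ ε₁ n m ε ≤ C * Real.exp (-μ * (n : ℝ))) ∧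
      ∀ (p : BB84.Parameters) (D : ℕ) (ρ : BB84.Source D) (β γ lam : ℝ),
        BB84.IsQuasiperfect ρ β γ → BB84.Conditions p β γ lam →
        ∀ (bt : BB84.Bits p.N) (J : Type*) (A : BB84.NormalizedAttack p ρ bt J),
          N₀ p.ε ≤ p.n → (p.m : ℝ) - ε₁ p.n p.m p.ε ≤ A.condEntropy := by
  refine ⟨fun n m ε => 8 * ((m : ℝ) + 2) * (2 * n + 1) * Real.exp (-(ε ^ 2 / 8) * n),
    fun _ => 0, fun ε hε l hl => ⟨ε ^ 2 / 16, by positivity,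
      8 * (l / (ε ^ 2 / 32) + 2) * (2 / (ε ^ 2 / 32) + 1), by positivity,
      fun n m hmn => ⟨by positivity, BB84.polynomial_mul_exp_le hε hl hmn⟩⟩, ?_⟩
  rintro p D ρ β γ lam ⟨hρ, P, Pt, hq⟩ hc bt J A -
  exact A.condEntropy_ge hq hρ hc
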